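/- Let $H(p)=\frac{3^3}{4^4}p_1^4+p_2^2$ for $p=(p_1,p_2)\in\mathbb{R}^2$. Then $H$ is strictly convex, coercive (i.e. $H(p)/|p|\to+\infty$ as $|p|\to\infty$) and of class $C^2$, but it is not uniformly directionally convex, i.e. it is not true that for every $R>0$ $$\inf_{p\neq q\in\overline{B}(0,R)}\left\langle \frac{DH(p)-DH(q)}{|DH(p)-DH(q)|},\frac{p-q}{|p-q|}\right\rangle>0 .$$ Let $L(q)=\sup_{p\in\mathbb{R}^2}\{\langle p,q\rangle-H(p)\}$ be the Legendre transform of $H$. There exists a Lipschitz function $\bar u:\mathbb{R}^2\to\mathbb{R}$ such that the function $u$ given by $u(0,\cdot)=\bar u$ and the Hopf–Lax formula $$u(t,x)=\inf_{y\in\mathbb{R}^2}\left\{\bar u(y)+t\,L\left(\frac{x-y}{t}\right)\right\},\qquad t>0,\ x\in\mathbb{R}^2,$$ has the following properties. (a) $u$ is continuous on $[0,\infty)\times\mathbb{R}^2$ and is a viscosity solution of $u_t+H(D_xu)=0$ on $(0,\infty)\times\mathbb{R}^2$ with $u(0,\cdot)=\bar u$. (b) For almost every $x\in\mathbb{R}^2$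 the function $u(1,\cdot)$ is differentiable at $x$, and the set of slopes of backward optimal rays $\{x-y:\ u(1,x)=\bar u(y)+L(x-y)\}$ consists of the single vector $\mathbf{b}(1,x):=DH(Du(1,x))$. (c) The vector fields $Du(1,\cdot)$ and $\mathbf{b}(1,\cdot)$ are locally integrable, and both have infinite total variation on $[0,1]^2$, and even on the open square $(0,1)^2$. Here, for $F\in L^1_{\mathrm{loc}}(\mathbb{R}^2,\mathbb{R}^2)$, the total variation on an open set $\Omega$ is $$|DF|(\Omega)=\sup\left\{\int_{\mathbb{R}^2} \sum_{i=1}^2F_i\,\mathrm{div}\,\varphi_i\,dx:\ \varphi_1,\varphi_2\in C^1_c(\Omega,\mathbb{R}^2),\ |\varphi_1|^2+|\varphi_2|^2\le 1\right\},$$ and on an arbitrary set $A$ it is the infimum of $|DF|(\Omega)$ over all open $\Omega\supseteq A$. Hence neither $Du(1,\cdot)$ nor $\mathbf{b}(1,\cdot)$ belongs to $BV_{\mathrm{loc}}(\mathbb{R}^2,\mathbb{R}^2)$. -/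

import Mathlib

open Set Filter Topology MeasureTheory
open scoped NNReal ENNReal

namespace HamiltonJacobi

noncomputable section

/-- Euclidean space `ℝ^d`. -/
abbrev Euc (d : ℕ) : Type := EuclideanSpace ℝ (Fin d)

/-- Superlinear growth: `H p / |p| → ∞` as `|p| → ∞`. -/
def Coercive {d : ℕ} (H : Euc d → ℝ) : Prop :=
  Tendsto (fun p => H p / ‖p‖) (Bornology.cobounded (Euc d)) atTop

/-- Uniform directional convexity: for every `R > 0`, the infimum over `p ≠ q` in the closed ball
of radius `R` of the cosine of the angle between `DH p - DH q` and `p - q` is positive. -/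
def UniformlyDirectionallyConvex {d : ℕ} (H : Euc d → ℝ) : Prop :=
  ∀ R : ℝ, 0 < R → ∃ c : ℝ, 0 < c ∧
    ∀ p ∈ Metric.closedBall (0 : Euc d) R, ∀ q ∈ Metric.closedBall (0 : Euc d) R, p ≠ q →
      c ≤ inner ℝ (‖gradient H p - gradient H q‖⁻¹ • (gradient H p - gradient H q))
        (‖p - q‖⁻¹ • (p - q))

/-- The Legendre transform of `H`. -/
def legendre {d : ℕ} (H : Euc d → ℝ) (q : Euc d) : ℝ :=
  ⨆ p : Euc d, (inner ℝ p q - H p)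

/-- The Hopf-Lax semigroup `S_t u₀ (x)`. For Lipschitz `u₀` and a strictly convex coercive `C¹`
function `H` the infimum is a minimum. -/
def hopfLax {d : ℕ} (H : Euc d → ℝ) (u₀ : Euc d → ℝ) (t : ℝ) (x : Euc d) : ℝ :=
  if t = 0 then u₀ x else ⨅ y : Euc d, (u₀ y + t * legendre H (t⁻¹ • (x - y)))

/-- The set of slopes of backward optimal rays through `(t, x)`. -/
def backwardSlopes {d : ℕ} (H : Euc d → ℝ) (u₀ : Euc d → ℝ) (t : ℝ) (x : Euc d) : Set (Euc d) :=
  {q | ∃ y : Euc d, q = t⁻¹ • (x - y) ∧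
    hopfLax H u₀ t x = u₀ y + t * legendre H (t⁻¹ • (x - y))}

/-- `u` is a (continuous) viscosity solution on `[0, ∞) × ℝ^d` of the Cauchy problem
`u_t + H (D_x u) = 0`, `u (0, ·) = u₀`. Values of `u` at negative times play no role. -/
structure IsViscositySolution {d : ℕ} (H : Euc d → ℝ) (u₀ : Euc d → ℝ)
    (u : ℝ → Euc d → ℝ) : Prop where
  continuousOn : ContinuousOn (fun z : ℝ × Euc d => u z.1 z.2) (Ici 0 ×ˢ univ)
  initial : ∀ x, u 0 x = u₀ x
  subsolution : ∀ (t₀ : ℝ) (x₀ : Euc d) (v : ℝ × Euc d → ℝ), 0 < t₀ →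
    ContDiffOn ℝ 1 v (Ioi 0 ×ˢ univ) →
    IsLocalMax (fun z : ℝ × Euc d => u z.1 z.2 - v z) (t₀, x₀) →
    deriv (fun t => v (t, x₀)) t₀ + H (gradient (fun x => v (t₀, x)) x₀) ≤ 0
  supersolution : ∀ (t₀ : ℝ) (x₀ : Euc d) (v : ℝ × Euc d → ℝ), 0 < t₀ →
    ContDiffOn ℝ 1 v (Ioi 0 ×ˢ univ) →
    IsLocalMin (fun z : ℝ × Euc d => u z.1 z.2 - v z) (t₀, x₀) →
    0 ≤ deriv (fun t => v (t, x₀)) t₀ + H (gradient (fun x => v (t₀, x)) x₀)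

/-- The velocity field `b (t, ·) = DH (D_x u (t, ·))` with `u (t, ·) = S_t u₀`. It is defined
at every point where `u (t, ·)` is differentiable, that is, almost everywhere. -/
def velocity {d : ℕ} (H : Euc d → ℝ) (u₀ : Euc d → ℝ) (t : ℝ) (x : Euc d) : Euc d :=
  gradient H (gradient (hopfLax H u₀ t) x)

/-- The divergence of a vector field. -/
def divergence {d : ℕ} (φ : Euc d → Euc d) (x : Euc d) : ℝ :=
  ∑ j : Fin d, fderiv ℝ φ x (EuclideanSpace.single j 1) j

/-- Matrix-valued test fields, given by their rows: `C¹`, compactly supported in `Ω`, and with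
Euclidean (Frobenius) norm at most `1` everywhere. -/
def IsTestField {d m : ℕ} (Ω : Set (Euc d)) (φ : Fin m → Euc d → Euc d) : Prop :=
  (∀ i, ContDiff ℝ 1 (φ i) ∧ HasCompactSupport (φ i) ∧ tsupport (φ i) ⊆ Ω) ∧
    ∀ x, ∑ i, ‖φ i x‖ ^ 2 ≤ 1

/-- The total variation `|DF|(Ω)` in an open set `Ω` of a locally integrable
`F : ℝ^d → ℝ^m`, as a supremum over test fields. -/
def variation {d m : ℕ} (F : Euc d → Euc m) (Ω : Set (Euc d)) : ℝ≥0∞ :=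
  ⨆ (φ : Fin m → Euc d → Euc d) (_ : IsTestField Ω φ),
    ENNReal.ofReal (∫ x, ∑ i, F x i * divergence (φ i) x)

/-- The total variation `|DF|(A)` on an arbitrary set `A`, by outer regularity. -/
def variationOn {d m : ℕ} (F : Euc d → Euc m) (A : Set (Euc d)) : ℝ≥0∞ :=
  ⨅ (Ω : Set (Euc d)) (_ : IsOpen Ω ∧ A ⊆ Ω), variation F Ω

/-- `F` belongs to `BV(Ω, ℝ^m)`, for an open set `Ω`. -/
def MemBV {d m : ℕ} (F : Euc d → Euc m) (Ω : Set (Euc d)) : Prop :=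
  IntegrableOn F Ω ∧ variation F Ω < ⊤

/-- `F` belongs to `BV_loc(ℝ^d, ℝ^m)`. -/
def MemBVLoc {d m : ℕ} (F : Euc d → Euc m) : Prop :=
  ∀ Ω : Set (Euc d), IsOpen Ω → Bornology.IsBounded Ω → MemBV F Ω

/-- The Hamiltonian `H p = (3³/4⁴) p₁⁴ + p₂²` on `ℝ²`. -/
def quarticHamiltonian (p : Euc 2) : ℝ := (3 ^ 3 / 4 ^ 4 : ℝ) * p 0 ^ 4 + p 1 ^ 2

/-- The closed unit square `[0,1]²`. -/
def closedUnitSquare : Set (Euc 2) := {x | ∀ i, x i ∈ Icc (0 : ℝ) 1}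

/-- The open unit square `(0,1)²`. -/
def openUnitSquare : Set (Euc 2) := {x | ∀ i, x i ∈ Ioo (0 : ℝ) 1}

end

end HamiltonJacobi

namespace HamiltonJacobi

/-! The Hamiltonian is quartic in `p 0` and quadratic in `p 1`. A wave of amplitude `A` with slopes
at most `P` and `Q` in the two coordinate directions survives the flow up to time 1 when `H (P, Q)`
is small compared with `A`. Indeed `W x - W (x - z) ≤ P |z 0| + Q |z 1| ≤ H (P, Q) + L z` for every
`z`, so the solution drops below the wave by at most `H (P, Q)`. With a large parameter `N` and `A ~
N⁻⁴`, this allows `P ~ N⁻¹` and `Q ~ N⁻²`, hence frequencies of order `N³` and `N²`. The mixed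
second derivative is then of order `A N³ N² ~ N`, which is unbounded. A Hamiltonian quadratic in
both directions would allow only frequencies `N²`, for which this product stays bounded.

The datum puts one such wave in each of the disjoint strips `x 0 ∈ [ℓ, 2ℓ]`, `ℓ = 4^{-(k+1)}`. The
amplitude carries an extra factor `ℓ²` and `N` is chosen so that `ℓ² N = k + 1`; the slopes stay
bounded, while the variation in the `k`-th strip is at least a constant times `k + 1`. No summation
over strips is needed.

Closeness to the wave is only uniform, so the variation is bounded from below by duality: both
derivatives in `∂₀∂₁ u` are moved onto a product test function of the same frequencies
(`ofReal_integral_le_variation`, `ofReal_le_variation_of_close`). Closeness itself is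
`abs_hopfLax_sub_stripWave_le`. Since the second component of `DH p` is `2 * p 1`, the same estimate
serves `Du` and the velocity.

The viscosity property and the uniqueness of backward slopes at points of differentiability are
general facts about Lipschitz data, proved with the Fenchel inequality; Rademacher's theorem gives
the almost everywhere statement. -/

/-- Differentiable strictly convex superlinear Hamiltonians, normalised by `0 ≤ H` and `H 0 = 0`.
Strict convexity is expressed by the tangent inequality, superlinearity by surjectivity of the
gradient. -/
structure IsNormalizedHamiltonian {d : ℕ} (H : Euc d → ℝ) : Prop where
  nonneg : ∀ p, 0 ≤ H p
  map_zero : H 0 = 0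
  continuous : Continuous H
  lt_of_ne : ∀ p p', p ≠ p' → H p + inner ℝ (gradient H p) (p' - p) < H p'
  surjective_gradient : Function.Surjective (gradient H)

/-! ### Legendre duality for normalised Hamiltonians. -/

section Legendre

variable {d : ℕ} {H : Euc d → ℝ}

theorem IsNormalizedHamiltonian.le_apply (hH : IsNormalizedHamiltonian H) (p p' : Euc d) :
    H p + inner ℝ (gradient H p) (p' - p) ≤ H p' := by
  rcases eq_or_ne p p' with rfl | h
  · simp
  · exact (hH.lt_of_ne p p' h).le

theorem IsNormalizedHamiltonian.bddAbove (hH : IsNormalizedHamiltonian H) (q : Euc d) :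
    BddAbove (range fun p : Euc d => inner ℝ p q - H p) := by
  obtain ⟨p, rfl⟩ := hH.surjective_gradient q
  refine ⟨inner ℝ p (gradient H p) - H p, ?_⟩
  rintro _ ⟨p', rfl⟩
  have h := hH.le_apply p p'
  rw [inner_sub_right, real_inner_comm p', real_inner_comm p] at h
  dsimp only
  linarith

theorem IsNormalizedHamiltonian.inner_le (hH : IsNormalizedHamiltonian H) (p q : Euc d) :
    inner ℝ p q ≤ H p + legendre H q := by
  have := le_ciSup (hH.bddAbove q) p
  unfold legendre
  linarith

/-- Equality case of the Fenchel inequality: the tangent inequality at `p` says that `p` maximises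
the expression defining the transform. -/
theorem IsNormalizedHamiltonian.legendre_gradient (hH : IsNormalizedHamiltonian H) (p : Euc d) :
    legendre H (gradient H p) = inner ℝ p (gradient H p) - H p := by
  refine le_antisymm (ciSup_le fun p' => ?_) ?_
  · have h := hH.le_apply p p'
    rw [inner_sub_right, real_inner_comm p', real_inner_comm p] at h
    linarith
  · have := hH.inner_le p (gradient H p)
    linarith

theorem IsNormalizedHamiltonian.legendre_nonneg (hH : IsNormalizedHamiltonian H) (q : Euc d) :
    0 ≤ legendre H q := by
  have := hH.inner_le 0 q
  rw [inner_zero_left, hH.map_zero] at this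
  linarith

theorem IsNormalizedHamiltonian.legendre_zero (hH : IsNormalizedHamiltonian H) :
    legendre H 0 = 0 := by
  refine le_antisymm (ciSup_le fun p => ?_) (hH.legendre_nonneg 0)
  have := hH.nonneg p
  rw [inner_zero_right]
  linarith

theorem IsNormalizedHamiltonian.convexOn_legendre (hH : IsNormalizedHamiltonian H) :
    ConvexOn ℝ univ (legendre H) := by
  refine ⟨convex_univ, fun q _ q' _ a b ha hb hab => ciSup_le fun p => ?_⟩
  have h₁ := mul_le_mul_of_nonneg_left (hH.inner_le p q) ha
  have h₂ := mul_le_mul_of_nonneg_left (hH.inner_le p q') hb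
  have h₃ : a * H p + b * H p = H p := by rw [← add_mul, hab, one_mul]
  rw [inner_add_right, inner_smul_right, inner_smul_right, smul_eq_mul, smul_eq_mul]
  linarith

theorem IsNormalizedHamiltonian.continuous_legendre (hH : IsNormalizedHamiltonian H) :
    Continuous (legendre H) :=
  continuousOn_univ.1 (hH.convexOn_legendre.continuousOn isOpen_univ)

/-- The Legendre transform grows faster than every linear function. -/
theorem IsNormalizedHamiltonian.exists_mul_norm_le (hH : IsNormalizedHamiltonian H) {K : ℝ}
    (hK : 0 ≤ K) : ∃ C, 0 ≤ C ∧ ∀ q, K * ‖q‖ ≤ C + legendre H q := by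
  -- `C` bounds `H` on the ball of radius `K`; testing the supremum with the vector of norm `K`
  -- parallel to `q` then gives the claim.
  obtain ⟨C, hC⟩ := (isCompact_closedBall (0 : Euc d) K).bddAbove_image hH.continuous.continuousOn
  have hC' : ∀ p : Euc d, ‖p‖ ≤ K → H p ≤ C := fun p hp =>
    hC ⟨p, by simpa using hp, rfl⟩
  refine ⟨C, (hH.nonneg 0).trans (hC' 0 (by simpa using hK)), fun q => ?_⟩
  rcases eq_or_ne q 0 with rfl | hq
  · have h₁ := hC' 0 (by simpa using hK)
    have h₂ := hH.nonneg 0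
    have h₃ := hH.legendre_nonneg 0
    simp only [norm_zero, mul_zero]
    linarith
  · have hq' : ‖q‖ ≠ 0 := norm_ne_zero_iff.2 hq
    have h := hH.inner_le ((K * ‖q‖⁻¹) • q) q
    have hn : ‖(K * ‖q‖⁻¹) • q‖ ≤ K := by
      rw [norm_smul, norm_mul, norm_inv, norm_norm, mul_assoc, inv_mul_cancel₀ hq', mul_one,
        Real.norm_of_nonneg hK]
    have := hC' _ hn
    rw [real_inner_smul_left, real_inner_self_eq_norm_sq] at h
    have e : K * ‖q‖⁻¹ * ‖q‖ ^ 2 = K * ‖q‖ := by field_simp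
    linarith

end Legendre

/-! ### The Hopf–Lax semigroup: regularity, viscosity property, backward rays. -/

section HopfLax

variable {d : ℕ} {H : Euc d → ℝ} {u₀ : Euc d → ℝ} {K : ℝ≥0}

theorem hopfLax_zero (H u₀ : Euc d → ℝ) : hopfLax H u₀ 0 = u₀ := by
  ext x
  simp [hopfLax]

/-- The Hopf-Lax formula in terms of the slope `z` of the ray. -/
theorem hopfLax_of_pos (H u₀ : Euc d → ℝ) {t : ℝ} (ht : 0 < t) (x : Euc d) :
    hopfLax H u₀ t x = ⨅ z : Euc d, (u₀ (x - t • z) + t * legendre H z) := by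
  rw [hopfLax, if_neg ht.ne']
  refine (Function.Surjective.iInf_congr (fun y => t⁻¹ • (x - y)) (fun z => ⟨x - t • z, ?_⟩)
    fun y => ?_)
  · simp [smul_smul, inv_mul_cancel₀ ht.ne']
  · simp [smul_smul, mul_inv_cancel₀ ht.ne']

theorem lipschitz_sub_le (hu : LipschitzWith K u₀) (x y : Euc d) :
    u₀ x - u₀ y ≤ K * ‖x - y‖ := by
  have := hu.dist_le_mul x y
  rw [Real.dist_eq, dist_eq_norm] at this
  exact (le_abs_self _).trans this

theorem bddBelow_hopfLax (hH : IsNormalizedHamiltonian H) (hu : LipschitzWith K u₀) {t : ℝ}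
    (ht : 0 ≤ t) (x : Euc d) :
    BddBelow (range fun z : Euc d => u₀ (x - t • z) + t * legendre H z) := by
  obtain ⟨C, -, hC⟩ := hH.exists_mul_norm_le K.2
  refine ⟨u₀ x - t * C, ?_⟩
  rintro _ ⟨z, rfl⟩
  have h₁ := lipschitz_sub_le hu x (x - t • z)
  have h₂ := mul_le_mul_of_nonneg_left (hC z) ht
  rw [sub_sub_cancel, norm_smul, Real.norm_of_nonneg ht] at h₁
  change t * (K * ‖z‖) ≤ _ at h₂
  dsimp only
  linarith

/-- Written with the slope `z` rather than the foot of the ray, the bound remains meaningful at `t =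
0`, so later arguments need no case distinction. -/
theorem hopfLax_le (hH : IsNormalizedHamiltonian H) (hu : LipschitzWith K u₀) {t : ℝ}
    (ht : 0 ≤ t) (x z : Euc d) :
    hopfLax H u₀ t x ≤ u₀ (x - t • z) + t * legendre H z := by
  rcases ht.eq_or_lt with rfl | ht'
  · simp [hopfLax_zero]
  · rw [hopfLax_of_pos H u₀ ht']
    exact ciInf_le (bddBelow_hopfLax hH hu ht x) z

theorem exists_hopfLax_eq (hH : IsNormalizedHamiltonian H) (hu : LipschitzWith K u₀) {t : ℝ}
    (ht : 0 ≤ t) (x : Euc d) :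
    ∃ z, hopfLax H u₀ t x = u₀ (x - t • z) + t * legendre H z := by
  rcases ht.eq_or_lt with rfl | ht'
  · exact ⟨0, by simp [hopfLax_zero]⟩
  · rw [hopfLax_of_pos H u₀ ht']
    have hcont : Continuous fun z : Euc d => u₀ (x - t • z) + t * legendre H z :=
      (hu.continuous.comp (by fun_prop)).add (continuous_const.mul hH.continuous_legendre)
    obtain ⟨C, -, hC⟩ := hH.exists_mul_norm_le (K := K + 1) (by positivity)
    have hlim : Tendsto (fun z : Euc d => u₀ (x - t • z) + t * legendre H z)
        (cocompact (Euc d)) atTop := by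
      have hn : Tendsto (fun z : Euc d => t * ‖z‖ + (u₀ x - t * C)) (cocompact (Euc d)) atTop :=
        tendsto_atTop_add_const_right _ _ ((tendsto_norm_cocompact_atTop).const_mul_atTop ht')
      refine tendsto_atTop_mono (fun z => ?_) hn
      have h₁ := lipschitz_sub_le hu x (x - t • z)
      have h₂ := mul_le_mul_of_nonneg_left (hC z) ht
      rw [sub_sub_cancel, norm_smul, Real.norm_of_nonneg ht] at h₁
      linarith
    obtain ⟨z, hz⟩ := hcont.exists_forall_le hlim
    exact ⟨z, le_antisymm (ciInf_le (bddBelow_hopfLax hH hu ht x) z) (le_ciInf hz)⟩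

theorem lipschitzWith_hopfLax (hH : IsNormalizedHamiltonian H) (hu : LipschitzWith K u₀) {t : ℝ}
    (ht : 0 ≤ t) : LipschitzWith K (hopfLax H u₀ t) := by
  refine LipschitzWith.of_le_add_mul K fun x y => ?_
  obtain ⟨z, hz⟩ := exists_hopfLax_eq hH hu ht y
  have h₁ := hopfLax_le hH hu ht x z
  have h₂ := lipschitz_sub_le hu (x - t • z) (y - t • z)
  rw [sub_sub_sub_cancel_right, ← dist_eq_norm] at h₂
  linarith

/-- Half of the dynamic programming principle. -/
theorem hopfLax_add_le (hH : IsNormalizedHamiltonian H) (hu : LipschitzWith K u₀) {t s : ℝ}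
    (ht : 0 ≤ t) (hs : 0 ≤ s) (x q : Euc d) :
    hopfLax H u₀ (t + s) x ≤ hopfLax H u₀ t (x - s • q) + s * legendre H q := by
  rcases (add_nonneg ht hs).eq_or_lt with h0 | hpos
  · obtain rfl : s = 0 := by linarith
    obtain rfl : t = 0 := by linarith
    simp
  obtain ⟨z, hz⟩ := exists_hopfLax_eq hH hu ht (x - s • q)
  -- By convexity of the transform, the straight ray with the averaged slope costs no more than the
  -- broken ray.
  have hconv := hH.convexOn_legendre.2 (mem_univ z) (mem_univ q)
    (div_nonneg ht hpos.le) (div_nonneg hs hpos.le) (by field_simp)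
  have h := hopfLax_le hH hu hpos.le x ((t / (t + s)) • z + (s / (t + s)) • q)
  have e : (t + s) • ((t / (t + s)) • z + (s / (t + s)) • q) = t • z + s • q := by
    rw [smul_add, smul_smul, smul_smul, mul_div_cancel₀ _ hpos.ne', mul_div_cancel₀ _ hpos.ne']
  rw [e] at h
  have h' := mul_le_mul_of_nonneg_left hconv hpos.le
  have e' : (t + s) * ((t / (t + s)) • legendre H z + (s / (t + s)) • legendre H q) =
      t * legendre H z + s * legendre H q := by
    simp only [smul_eq_mul]
    field_simp
  rw [e'] at h'
  have e'' : x - s • q - t • z = x - (t • z + s • q) := by abel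
  rw [hz, e'']
  linarith

theorem hopfLax_antitone (hH : IsNormalizedHamiltonian H) (hu : LipschitzWith K u₀) {s t : ℝ}
    (hs : 0 ≤ s) (hst : s ≤ t) (x : Euc d) : hopfLax H u₀ t x ≤ hopfLax H u₀ s x := by
  have := hopfLax_add_le hH hu hs (sub_nonneg.2 hst) x 0
  simpa [hH.legendre_zero] using this

/-- Keep the slope optimal at time `t` and stop at time `s`: the foot moves by `(t - s) ‖z‖`, and
superlinearity absorbs the resulting change of the datum into the cost saved. -/
theorem exists_hopfLax_le_add (hH : IsNormalizedHamiltonian H) (hu : LipschitzWith K u₀) :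
    ∃ C, 0 ≤ C ∧ ∀ s t : ℝ, 0 ≤ s → s ≤ t → ∀ x : Euc d,
      hopfLax H u₀ s x ≤ hopfLax H u₀ t x + C * (t - s) := by
  obtain ⟨C, hC0, hC⟩ := hH.exists_mul_norm_le K.2
  refine ⟨C, hC0, fun s t hs hst x => ?_⟩
  obtain ⟨z, hz⟩ := exists_hopfLax_eq hH hu (hs.trans hst) x
  have h₁ := hopfLax_le hH hu hs x z
  have h₂ := lipschitz_sub_le hu (x - s • z) (x - t • z)
  have h₃ := mul_le_mul_of_nonneg_left (hC z) (sub_nonneg.2 hst)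
  have e : x - s • z - (x - t • z) = (t - s) • z := by rw [sub_smul]; abel
  rw [e, norm_smul, Real.norm_of_nonneg (sub_nonneg.2 hst)] at h₂
  change (t - s) * (K * ‖z‖) ≤ _ at h₃
  linarith

theorem continuousOn_hopfLax (hH : IsNormalizedHamiltonian H) (hu : LipschitzWith K u₀) :
    ContinuousOn (fun z : ℝ × Euc d => hopfLax H u₀ z.1 z.2) (Ici 0 ×ˢ univ) := by
  obtain ⟨C, hC0, hC⟩ := exists_hopfLax_le_add hH hu
  have key : ∀ x : Euc d, LipschitzOnWith ⟨C, hC0⟩ (fun t => hopfLax H u₀ t x) (Ici 0) := by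
    intro x
    refine LipschitzOnWith.of_le_add_mul _ fun s hs t ht => ?_
    change _ ≤ _ + C * _
    rcases le_total s t with h | h
    · have := hC s t hs h x
      rwa [Real.dist_eq, abs_sub_comm, abs_of_nonneg (sub_nonneg.2 h)]
    · have h₁ := hopfLax_antitone hH hu ht h x
      have : 0 ≤ C * dist s t := mul_nonneg hC0 dist_nonneg
      linarith
  exact continuousOn_prod_of_continuousOn_lipschitzOnWith' _ K
    (fun t ht => (lipschitzWith_hopfLax hH hu ht).lipschitzOnWith)
    (fun x _ => (key x).continuousOn)

theorem nonneg_of_hasDerivAt_of_eventually_le {h : ℝ → ℝ} {h' : ℝ} (hd : HasDerivAt h h' 0)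
    (hle : ∀ᶠ s in 𝓝[>] 0, h 0 ≤ h s) : 0 ≤ h' := by
  have hs := hasDerivWithinAt_iff_tendsto_slope' (s := Ioi (0 : ℝ)) (by simp) |>.1
    (hd.hasDerivWithinAt (s := Ioi 0))
  refine ge_of_tendsto hs ?_
  filter_upwards [hle, self_mem_nhdsWithin] with s hs hpos
  rw [slope_def_field]
  exact div_nonneg (sub_nonneg.2 hs) (by simpa using (mem_Ioi.1 hpos).le)

/-- The derivative of a test function along the backward ray of slope `q`. -/
theorem hasDerivAt_backward {v : ℝ × Euc d → ℝ} {t₀ : ℝ} (x₀ : Euc d) (ht : 0 < t₀)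
    (hv : ContDiffOn ℝ 1 v (Ioi 0 ×ˢ univ)) (q : Euc d) :
    HasDerivAt (fun s : ℝ => v (t₀ - s, x₀ - s • q))
      (-(deriv (fun t => v (t, x₀)) t₀ + inner ℝ (gradient (fun x => v (t₀, x)) x₀) q)) 0 := by
  have hopen : (Ioi (0 : ℝ) ×ˢ (univ : Set (Euc d))) ∈ 𝓝 (t₀, x₀) :=
    (isOpen_Ioi.prod isOpen_univ).mem_nhds ⟨ht, mem_univ _⟩
  have hd : HasFDerivAt v (fderiv ℝ v (t₀, x₀)) (t₀, x₀) :=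
    ((hv.contDiffAt hopen).differentiableAt (by simp)).hasFDerivAt
  have h₁ : HasDerivAt (fun t => v (t, x₀)) (fderiv ℝ v (t₀, x₀) (1, 0)) t₀ :=
    hd.comp_hasDerivAt (f := fun t => (t, x₀)) t₀
      ((hasDerivAt_id t₀).prodMk (hasDerivAt_const t₀ x₀))
  have h₂ : HasFDerivAt (fun x => v (t₀, x))
      ((fderiv ℝ v (t₀, x₀)).comp (ContinuousLinearMap.inr ℝ ℝ (Euc d))) x₀ :=
    hd.comp x₀ (hasFDerivAt_prodMk_right t₀ x₀)
  have h₃ : HasDerivAt (fun s : ℝ => (t₀ - s, x₀ - s • q)) (-1, -q) 0 := by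
    have ha : HasDerivAt (fun s : ℝ => t₀ - s) (-1) 0 := by
      simpa using (hasDerivAt_id (0 : ℝ)).const_sub t₀
    have hb : HasDerivAt (fun s : ℝ => x₀ - s • q) (-q) 0 := by
      simpa using ((hasDerivAt_id (0 : ℝ)).smul_const q).const_sub x₀
    exact ha.prodMk hb
  have hd' : HasFDerivAt v (fderiv ℝ v (t₀, x₀)) (t₀ - 0, x₀ - (0 : ℝ) • q) := by simpa using hd
  have h₄ := hd'.comp_hasDerivAt (f := fun s : ℝ => (t₀ - s, x₀ - s • q)) 0 h₃
  refine h₄.congr_deriv ?_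
  rw [h₁.deriv, inner_gradient_left, h₂.fderiv, ContinuousLinearMap.comp_apply,
    ContinuousLinearMap.inr_apply, ← map_add, ← map_neg]
  simp

theorem isViscositySolution_hopfLax (hH : IsNormalizedHamiltonian H) (hu : LipschitzWith K u₀) :
    IsViscositySolution H u₀ (hopfLax H u₀) where
  continuousOn := continuousOn_hopfLax hH hu
  initial x := by rw [hopfLax_zero]
  subsolution t₀ x₀ v ht hv hmax := by
    set p := gradient (fun x => v (t₀, x)) x₀ with hp
    -- The ray of slope `DH p` gives equality in the Fenchel inequality, which turns the dynamic
    -- programming inequality into the equation.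
    set q := gradient H p with hq
    have hd := (hasDerivAt_backward x₀ ht hv q).add
      ((hasDerivAt_id (0 : ℝ)).mul_const (legendre H q))
    have hpath : Tendsto (fun s : ℝ => (t₀ - s, x₀ - s • q)) (𝓝[>] 0) (𝓝 (t₀, x₀)) := by
      have : Continuous (fun s : ℝ => (t₀ - s, x₀ - s • q)) := by fun_prop
      simpa using (this.tendsto 0).mono_left nhdsWithin_le_nhds
    have h := nonneg_of_hasDerivAt_of_eventually_le hd (by
      filter_upwards [hpath.eventually hmax, self_mem_nhdsWithin,
        mem_nhdsWithin_of_mem_nhds (Iio_mem_nhds ht)] with s hs hpos hlt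
      have h := hopfLax_add_le hH hu (sub_nonneg.2 (mem_Iio.1 hlt).le) (mem_Ioi.1 hpos).le x₀ q
      rw [sub_add_cancel] at h
      simp only [Pi.add_apply, sub_zero, zero_smul, id, zero_mul, add_zero]
      linarith)
    have hL := hH.legendre_gradient p
    rw [← hq] at hL
    rw [← hp, hL] at h
    linarith
  supersolution t₀ x₀ v ht hv hmin := by
    set p := gradient (fun x => v (t₀, x)) x₀ with hp
    -- Along an optimal ray the value at intermediate times is controlled by the remaining cost; the
    -- Fenchel inequality alone then suffices.
    obtain ⟨q, hq⟩ := exists_hopfLax_eq hH hu ht.le x₀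
    have hd := ((hasDerivAt_backward x₀ ht hv q).add
      ((hasDerivAt_id (0 : ℝ)).mul_const (legendre H q))).neg
    have hpath : Tendsto (fun s : ℝ => (t₀ - s, x₀ - s • q)) (𝓝[>] 0) (𝓝 (t₀, x₀)) := by
      have : Continuous (fun s : ℝ => (t₀ - s, x₀ - s • q)) := by fun_prop
      simpa using (this.tendsto 0).mono_left nhdsWithin_le_nhds
    have h := nonneg_of_hasDerivAt_of_eventually_le hd (by
      filter_upwards [hpath.eventually hmin, self_mem_nhdsWithin,
        mem_nhdsWithin_of_mem_nhds (Iio_mem_nhds ht)] with s hs hpos hlt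
      have h := hopfLax_le hH hu (sub_nonneg.2 (mem_Iio.1 hlt).le) (x₀ - s • q) q
      have e : x₀ - s • q - (t₀ - s) • q = x₀ - t₀ • q := by rw [sub_smul]; abel
      rw [e] at h
      simp only [Pi.add_apply, Pi.neg_apply, sub_zero, zero_smul, id, zero_mul, add_zero]
      linarith)
    have hF := hH.inner_le p q
    rw [← hp] at h
    linarith

/-- At a point of differentiability of the solution the backward optimal ray is unique, and its
slope is the velocity. -/
theorem backwardSlopes_eq_singleton (hH : IsNormalizedHamiltonian H) (hu : LipschitzWith K u₀)
    {t : ℝ} (ht : 0 < t) {x : Euc d} (hx : DifferentiableAt ℝ (hopfLax H u₀ t) x) :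
    backwardSlopes H u₀ t x = {velocity H u₀ t x} := by
  set p := gradient (hopfLax H u₀ t) x with hp
  have key : ∀ q : Euc d, hopfLax H u₀ t x = u₀ (x - t • q) + t * legendre H q →
      q = gradient H p := by
    intro q hq
    -- The gradient `p` of the solution is a subgradient of the transform at every optimal slope
    -- `q`: displace `x` by `s t w` and the slope by `s w`, so that the foot of the ray stays fixed.
    have hsub : ∀ w : Euc d, legendre H q + inner ℝ p w ≤ legendre H (q + w) := by
      intro w
      have hline : HasDerivAt (fun s : ℝ => hopfLax H u₀ t (x + s • (t • w)))
          (inner ℝ p (t • w)) 0 := by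
        have hd : HasFDerivAt (hopfLax H u₀ t) (fderiv ℝ (hopfLax H u₀ t) x)
            (x + (0 : ℝ) • (t • w)) := by simpa using hx.hasFDerivAt
        have hb : HasDerivAt (fun s : ℝ => x + s • (t • w)) (t • w) 0 := by
          simpa using ((hasDerivAt_id (0 : ℝ)).smul_const (t • w)).const_add x
        have := hd.comp_hasDerivAt (f := fun s : ℝ => x + s • (t • w)) 0 hb
        rwa [← inner_gradient_left] at this
      have hd := ((hasDerivAt_id (0 : ℝ)).mul_const
        (t * (legendre H (q + w) - legendre H q))).sub hline
      have h := nonneg_of_hasDerivAt_of_eventually_le hd (by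
        filter_upwards [self_mem_nhdsWithin,
          mem_nhdsWithin_of_mem_nhds (Iio_mem_nhds (one_pos (α := ℝ)))] with s hpos hlt
        have h := hopfLax_le hH hu ht.le (x + s • (t • w)) (q + s • w)
        have e : x + s • (t • w) - t • (q + s • w) = x - t • q := by
          rw [smul_add, smul_comm s t w]; abel
        rw [e] at h
        have hc := hH.convexOn_legendre.2 (mem_univ q) (mem_univ (q + w))
          (sub_nonneg.2 (mem_Iio.1 hlt).le) (mem_Ioi.1 hpos).le (by ring)
        have e' : (1 - s) • q + s • (q + w) = q + s • w := by
          rw [sub_smul, one_smul, smul_add]; abel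
        rw [e', smul_eq_mul, smul_eq_mul] at hc
        have hc' := mul_le_mul_of_nonneg_left hc ht.le
        simp only [Pi.sub_apply, zero_smul, id, zero_mul, add_zero]
        linarith)
      rw [inner_smul_right, one_mul, ← mul_sub] at h
      have := nonneg_of_mul_nonneg_right h ht
      linarith
    obtain ⟨p', rfl⟩ := hH.surjective_gradient q
    by_contra hne
    have hne' : p' ≠ p := fun h => hne (by rw [h])
    -- For this `w` the subgradient inequality becomes the reverse of the strict tangent inequality
    -- at `p'`.
    have h₁ := hsub (gradient H p - gradient H p')
    rw [add_sub_cancel, hH.legendre_gradient p, hH.legendre_gradient p', inner_sub_right] at h₁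
    have h₂ := hH.lt_of_ne p' p hne'
    rw [inner_sub_right, real_inner_comm p, real_inner_comm p'] at h₂
    linarith
  ext q
  simp only [backwardSlopes, mem_ofPred_eq, mem_singleton_iff, velocity]
  constructor
  · rintro ⟨y, rfl, hy⟩
    refine key _ ?_
    rwa [smul_smul, mul_inv_cancel₀ ht.ne', one_smul, sub_sub_cancel]
  · rintro rfl
    obtain ⟨z, hz⟩ := exists_hopfLax_eq hH hu ht.le x
    have e := key z hz
    have e' : t⁻¹ • (x - (x - t • z)) = z := by
      rw [sub_sub_cancel, smul_smul, inv_mul_cancel₀ ht.ne', one_smul]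
    exact ⟨x - t • z, by rw [e', e], by rw [e']; exact hz⟩

end HopfLax

/-! ### Local integrability of the gradient and of the velocity. -/

section Measurability

variable {d : ℕ}

theorem measurable_gradient (f : Euc d → ℝ) : Measurable (gradient f) :=
  (LinearIsometryEquiv.continuous _).measurable.comp (measurable_fderiv ℝ f)

theorem norm_gradient_le {f : Euc d → ℝ} {K : ℝ≥0} (hf : LipschitzWith K f) (x : Euc d) :
    ‖gradient f x‖ ≤ K := by
  rw [gradient, LinearIsometryEquiv.norm_map]
  exact norm_fderiv_le_of_lipschitz ℝ hf

theorem locallyIntegrable_of_norm_le {F : Euc d → Euc d} (hF : Measurable F) {C : ℝ}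
    (hC : ∀ x, ‖F x‖ ≤ C) : LocallyIntegrable F :=
  (locallyIntegrable_const C).mono hF.aestronglyMeasurable
    (Eventually.of_forall fun x => (hC x).trans (le_abs_self C))

theorem locallyIntegrable_gradient {f : Euc d → ℝ} {K : ℝ≥0} (hf : LipschitzWith K f) :
    LocallyIntegrable (gradient f) :=
  locallyIntegrable_of_norm_le (measurable_gradient f) (norm_gradient_le hf)

theorem locallyIntegrable_comp_gradient {f : Euc d → ℝ} {K : ℝ≥0} (hf : LipschitzWith K f)
    {G : Euc d → Euc d} (hG : Continuous G) :
    LocallyIntegrable (fun x => G (gradient f x)) := by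
  obtain ⟨C, hC⟩ := (isCompact_closedBall (0 : Euc d) K).bddAbove_image hG.norm.continuousOn
  exact locallyIntegrable_of_norm_le (hG.measurable.comp (measurable_gradient f))
    fun x => hC ⟨gradient f x, by simpa using norm_gradient_le hf x, rfl⟩

end Measurability

/-! ### Monotonicity of the total variation. -/

section Variation

variable {d m : ℕ}

theorem variation_mono (F : Euc d → Euc m) {Ω Ω' : Set (Euc d)} (h : Ω ⊆ Ω') :
    variation F Ω ≤ variation F Ω' :=
  iSup₂_le fun φ hφ => le_iSup₂_of_le φ
    ⟨fun i => ⟨(hφ.1 i).1, (hφ.1 i).2.1, (hφ.1 i).2.2.trans h⟩, hφ.2⟩ le_rfl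

theorem variationOn_eq_top_of_subset {F : Euc d → Euc m} {Ω A : Set (Euc d)} (h : Ω ⊆ A)
    (hF : variation F Ω = ⊤) : variationOn F A = ⊤ := by
  refine top_unique (le_iInf₂ fun Ω' hΩ' => ?_)
  rw [← hF]
  exact variation_mono F (h.trans hΩ'.2)

end Variation

/-! ### Convexity properties of the quartic Hamiltonian. -/

section QuarticHamiltonian

theorem IsNormalizedHamiltonian.strictConvexOn {d : ℕ} {H : Euc d → ℝ}
    (hH : IsNormalizedHamiltonian H) : StrictConvexOn ℝ univ H := by
  refine ⟨convex_univ, fun x _ y _ hxy a b ha hb hab => ?_⟩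
  set z := a • x + b • y with hz
  have hx : x - z = b • (x - y) := by
    rw [hz, ← sub_eq_iff_eq_add'.2 hab.symm, sub_smul, smul_sub, one_smul]
    module
  have hy : y - z = -(a • (x - y)) := by
    rw [hz, eq_sub_of_add_eq' hab]
    module
  have hne : x - y ≠ 0 := sub_ne_zero.2 hxy
  have hzx : z ≠ x := fun h => by
    rw [← h, sub_self] at hx
    exact smul_ne_zero hb.ne' (h ▸ hne) hx.symm
  have h₁ := hH.lt_of_ne z x hzx
  have h₂ := hH.le_apply z y
  rw [hx, inner_smul_right] at h₁
  rw [hy, inner_neg_right, inner_smul_right] at h₂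
  have h₃ := mul_lt_mul_of_pos_left h₁ ha
  have h₄ := mul_le_mul_of_nonneg_left h₂ hb.le
  have h₅ : a * H z + b * H z = H z := by rw [← add_mul, hab, one_mul]
  simp only [smul_eq_mul]
  linarith

theorem quarticHamiltonian_eq (p : Euc 2) :
    quarticHamiltonian p = 27 / 256 * p 0 ^ 4 + p 1 ^ 2 := by
  rw [quarticHamiltonian]
  norm_num

theorem contDiff_quarticHamiltonian {n : WithTop ℕ∞} : ContDiff ℝ n quarticHamiltonian := by
  have h : ∀ i : Fin 2, ContDiff ℝ n (fun p : Euc 2 => p i) := fun i =>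
    (EuclideanSpace.proj (𝕜 := ℝ) i).contDiff
  exact (contDiff_const.mul ((h 0).pow 4)).add ((h 1).pow 2)

theorem inner_euc_two (p q : Euc 2) : inner ℝ p q = p 0 * q 0 + p 1 * q 1 := by
  simp [PiLp.inner_apply, mul_comm]

theorem norm_sq_euc_two (p : Euc 2) : ‖p‖ ^ 2 = p 0 ^ 2 + p 1 ^ 2 := by
  simp [EuclideanSpace.norm_sq_eq]

theorem abs_apply_le_norm (p : Euc 2) (i : Fin 2) : |p i| ≤ ‖p‖ :=
  PiLp.norm_apply_le p i

theorem gradient_quarticHamiltonian (p : Euc 2) :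
    gradient quarticHamiltonian p = !₂[27 / 64 * p 0 ^ 3, 2 * p 1] := by
  apply HasGradientAt.gradient
  rw [hasGradientAt_iff_hasFDerivAt]
  have h : ∀ i : Fin 2, HasFDerivAt (fun p : Euc 2 => p i) (EuclideanSpace.proj (𝕜 := ℝ) i) p :=
    fun i => (EuclideanSpace.proj (𝕜 := ℝ) i).hasFDerivAt
  have h' := (((h 0).pow 4).const_mul (3 ^ 3 / 4 ^ 4 : ℝ)).add ((h 1).pow 2)
  refine h'.congr_fderiv ?_
  ext v
  simp only [InnerProductSpace.toDual_apply_apply, inner_euc_two]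
  simp
  ring

theorem exists_pow_three_eq (y : ℝ) : ∃ x : ℝ, x ^ 3 = y := by
  rcases le_total 0 y with h | h
  · exact ⟨y ^ ((3 : ℕ) : ℝ)⁻¹, Real.rpow_inv_natCast_pow h (by norm_num)⟩
  · refine ⟨-(-y) ^ ((3 : ℕ) : ℝ)⁻¹, ?_⟩
    rw [Odd.neg_pow (by decide), Real.rpow_inv_natCast_pow (by linarith) (by norm_num), neg_neg]

theorem isNormalizedHamiltonian_quarticHamiltonian :
    IsNormalizedHamiltonian quarticHamiltonian where
  nonneg p := by rw [quarticHamiltonian_eq]; positivity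
  map_zero := by simp [quarticHamiltonian_eq]
  continuous := (contDiff_quarticHamiltonian (n := 0)).continuous
  lt_of_ne p p' hne := by
    rw [gradient_quarticHamiltonian, inner_euc_two, quarticHamiltonian_eq, quarticHamiltonian_eq]
    simp only [PiLp.sub_apply, Matrix.cons_val_zero, Matrix.cons_val_one]
    have e : 27 / 256 * p' 0 ^ 4 + p' 1 ^ 2 - (27 / 256 * p 0 ^ 4 + p 1 ^ 2 +
        (27 / 64 * p 0 ^ 3 * (p' 0 - p 0) + 2 * p 1 * (p' 1 - p 1))) =
        27 / 256 * ((p' 0 - p 0) ^ 2 * ((p' 0 + p 0) ^ 2 + 2 * p 0 ^ 2)) +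
          (p' 1 - p 1) ^ 2 := by ring
    rw [← sub_pos, e]
    by_cases h0 : p' 0 = p 0
    · have h1 : p' 1 - p 1 ≠ 0 := fun h1 => hne (by
        ext i
        fin_cases i
        · exact h0.symm
        · exact (sub_eq_zero.1 h1).symm)
      positivity
    · have h1 : p' 0 - p 0 ≠ 0 := sub_ne_zero.2 h0
      have h2 : 0 < (p' 0 + p 0) ^ 2 + 2 * p 0 ^ 2 := by
        by_cases h3 : p 0 = 0
        · have : p' 0 + p 0 ≠ 0 := by rw [h3] at h0 ⊢; simpa using h0
          positivity
        · positivity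
      positivity
  surjective_gradient q := by
    obtain ⟨a, ha⟩ := exists_pow_three_eq (64 / 27 * q 0)
    refine ⟨!₂[a, q 1 / 2], ?_⟩
    rw [gradient_quarticHamiltonian]
    ext i
    fin_cases i
    · simp [ha]; ring
    · simp; ring

theorem continuous_gradient_quarticHamiltonian : Continuous (gradient quarticHamiltonian) := by
  have h : (gradient quarticHamiltonian) = fun p => !₂[27 / 64 * p 0 ^ 3, 2 * p 1] :=
    funext gradient_quarticHamiltonian
  rw [h]
  fun_prop

theorem coercive_quarticHamiltonian : Coercive quarticHamiltonian := by
  have h : Tendsto (fun p : Euc 2 => 27 / 128 * ‖p‖ + (-1)) (Bornology.cobounded (Euc 2)) atTop :=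
    tendsto_atTop_add_const_right _ _ (tendsto_norm_cobounded_atTop.const_mul_atTop (by norm_num))
  refine tendsto_atTop_mono' _ ?_ h
  filter_upwards [tendsto_norm_cobounded_atTop.eventually_ge_atTop 1] with p hp
  rw [le_div_iff₀ (by linarith), quarticHamiltonian_eq]
  nlinarith [sq_nonneg (p 0 ^ 2 - 1), norm_sq_euc_two p, sq_nonneg (p 1)]

theorem not_uniformlyDirectionallyConvex_quarticHamiltonian :
    ¬ UniformlyDirectionallyConvex quarticHamiltonian := by
  intro h
  obtain ⟨c, hc, h⟩ := h 2 (by norm_num)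
  obtain ⟨s, hs0, hs1, hsc⟩ : ∃ s : ℝ, 0 < s ∧ s ≤ 1 ∧ s ≤ c / 2 :=
    ⟨min 1 (c / 2), by positivity, min_le_left _ _, min_le_right _ _⟩
  -- Along this parabola `DH p` is of order `s²` and nearly vertical while `p` is nearly horizontal;
  -- the inner product is of order `s⁴`, so the cosine of the angle with the origin as second point
  -- is of order `s`.
  set p : Euc 2 := !₂[s, s ^ 2] with hp
  have hp0 : p 0 = s := rfl
  have hp1 : p 1 = s ^ 2 := rfl
  have hs2 : s ^ 2 ≤ 1 := pow_le_one₀ hs0.le hs1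
  have hpn : ‖p‖ ≤ 2 := by
    refine le_of_sq_le_sq ?_ (by norm_num)
    rw [norm_sq_euc_two, hp0, hp1]
    nlinarith
  have hlow : s ≤ ‖p‖ := by simpa [hp0, abs_of_pos hs0] using abs_apply_le_norm p 0
  have hgz : gradient quarticHamiltonian (0 : Euc 2) = 0 := by
    rw [gradient_quarticHamiltonian]
    ext i
    fin_cases i <;> simp
  have hg : gradient quarticHamiltonian p = !₂[27 / 64 * s ^ 3, 2 * s ^ 2] := by
    rw [gradient_quarticHamiltonian, hp0, hp1]
  set g := gradient quarticHamiltonian p with hgdef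
  have hlow' : 2 * s ^ 2 ≤ ‖g‖ := by
    have := abs_apply_le_norm g 1
    rw [hg] at this ⊢
    exact (le_abs_self _).trans this
  have hne : p ≠ 0 := fun h0 => by
    have : p 0 = 0 := by rw [h0]; rfl
    linarith
  have hin : inner ℝ g p ≤ 3 * s ^ 4 := by
    rw [inner_euc_two, hg, hp0, hp1]
    simp only [Matrix.cons_val_zero, Matrix.cons_val_one]
    nlinarith [pow_pos hs0 4]
  have key := h p (by simpa using hpn) 0 (by simp) hne
  rw [← hgdef, hgz, sub_zero, sub_zero, real_inner_smul_left, real_inner_smul_right] at key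
  have hpp : 0 < ‖p‖ := hs0.trans_le hlow
  have hgp : 0 < ‖g‖ := lt_of_lt_of_le (by positivity) hlow'
  have key' : c * (‖g‖ * ‖p‖) ≤ inner ℝ g p := by
    rw [← mul_assoc, ← mul_inv, ← div_eq_inv_mul, le_div_iff₀ (by positivity)] at key
    exact key
  have h₁ : 2 * s ^ 2 * s ≤ ‖g‖ * ‖p‖ := mul_le_mul hlow' hlow hs0.le hgp.le
  have h₂ := mul_le_mul_of_nonneg_left h₁ hc.le
  have h₃ : 2 * s * (2 * s ^ 2 * s) ≤ c * (2 * s ^ 2 * s) := by gcongr; linarith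
  nlinarith [pow_pos hs0 4]

end QuarticHamiltonian

/-! ### One-dimensional oscillating profiles and their integrals. -/

section Profiles

/-- The projection of `ℝ` onto `[0, n π]`. -/
noncomputable def clampPi (n : ℕ) (t : ℝ) : ℝ := max 0 (min t (n * Real.pi))

/-- The function equal to `sin²` on `[0, n π]` and to `0` elsewhere. -/
noncomputable def sinSqProfile (n : ℕ) (t : ℝ) : ℝ := Real.sin (clampPi n t) ^ 2

/-- The function equal to `(sin³ cos)'` on `[0, n π]` and to `0` elsewhere. -/
noncomputable def sinCubeCosDeriv (n : ℕ) (t : ℝ) : ℝ :=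
  3 * Real.sin (clampPi n t) ^ 2 - 4 * Real.sin (clampPi n t) ^ 4

/-- The function equal to `sin³ cos` on `[0, n π]` and to `0` elsewhere. -/
noncomputable def sinCubeCosProfile (n : ℕ) (t : ℝ) : ℝ :=
  Real.sin (clampPi n t) ^ 3 * Real.cos (clampPi n t)

theorem lipschitzWith_clampPi (n : ℕ) : LipschitzWith 1 (clampPi n) :=
  (LipschitzWith.id.min_const _).const_max _

theorem clampPi_of_mem {n : ℕ} {t : ℝ} (h₀ : 0 ≤ t) (h₁ : t ≤ n * Real.pi) : clampPi n t = t := by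
  rw [clampPi, min_eq_left h₁, max_eq_right h₀]

theorem sin_clampPi_of_notMem {n : ℕ} {t : ℝ} (h : t ∉ Ioo 0 (n * Real.pi)) :
    Real.sin (clampPi n t) = 0 := by
  have hn : 0 ≤ n * Real.pi := by positivity
  rcases le_or_gt t 0 with h₀ | h₀
  · rw [clampPi, max_eq_left ((min_le_left _ _).trans h₀), Real.sin_zero]
  · rw [clampPi, min_eq_right (not_lt.1 fun h₁ => h ⟨h₀, h₁⟩), max_eq_right hn,
      Real.sin_nat_mul_pi]

theorem sinSqProfile_nonneg (n : ℕ) (t : ℝ) : 0 ≤ sinSqProfile n t := sq_nonneg _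

theorem sinSqProfile_le_one (n : ℕ) (t : ℝ) : sinSqProfile n t ≤ 1 := Real.sin_sq_le_one _

theorem sinSqProfile_of_notMem {n : ℕ} {t : ℝ} (h : t ∉ Ioo 0 (n * Real.pi)) :
    sinSqProfile n t = 0 := by
  simp [sinSqProfile, sin_clampPi_of_notMem h]

theorem sinCubeCosDeriv_of_notMem {n : ℕ} {t : ℝ} (h : t ∉ Ioo 0 (n * Real.pi)) :
    sinCubeCosDeriv n t = 0 := by
  simp [sinCubeCosDeriv, sin_clampPi_of_notMem h]

theorem sinCubeCosProfile_of_notMem {n : ℕ} {t : ℝ} (h : t ∉ Ioo 0 (n * Real.pi)) :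
    sinCubeCosProfile n t = 0 := by
  simp [sinCubeCosProfile, sin_clampPi_of_notMem h]

theorem abs_sinCubeCosProfile_le_one (n : ℕ) (t : ℝ) : |sinCubeCosProfile n t| ≤ 1 := by
  rw [sinCubeCosProfile, abs_mul, abs_pow]
  exact mul_le_one₀ (pow_le_one₀ (abs_nonneg _) (Real.abs_sin_le_one _)) (abs_nonneg _)
    (Real.abs_cos_le_one _)

theorem abs_sinCubeCosDeriv_le_one (n : ℕ) (t : ℝ) : |sinCubeCosDeriv n t| ≤ 1 := by
  have h₀ := sq_nonneg (Real.sin (clampPi n t))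
  have h₁ := Real.sin_sq_le_one (clampPi n t)
  rw [sinCubeCosDeriv, abs_le]
  -- With `y = sin²`, the polynomial `3 y - 4 y²` has its maximum `9/16` at `y = 3/8` and its
  -- minimum `-1` on `[0, 1]` at `y = 1`.
  constructor <;> nlinarith [sq_nonneg (Real.sin (clampPi n t) ^ 2 - 3 / 8)]

theorem lipschitzWith_sinSqProfile (n : ℕ) : LipschitzWith 1 (sinSqProfile n) := by
  have h : LipschitzWith 1 (fun t => Real.sin t ^ 2) := by
    refine lipschitzWith_of_nnnorm_deriv_le (by fun_prop) fun t => ?_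
    have : HasDerivAt (fun t => Real.sin t ^ 2) (Real.sin (2 * t)) t := by
      refine ((Real.hasDerivAt_sin t).pow 2).congr_deriv ?_
      rw [Real.sin_two_mul]
      simp
    rw [this.deriv]
    exact Real.abs_sin_le_one _
  have h' := h.comp (lipschitzWith_clampPi n)
  rw [mul_one] at h'
  exact h'

theorem hasDerivAt_sin_cube_mul_cos (t : ℝ) :
    HasDerivAt (fun t => Real.sin t ^ 3 * Real.cos t)
      (3 * Real.sin t ^ 2 - 4 * Real.sin t ^ 4) t := by
  refine (((Real.hasDerivAt_sin t).pow 3).mul (Real.hasDerivAt_cos t)).congr_deriv ?_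
  have h := Real.sin_sq_add_cos_sq t
  have h' : Real.cos t ^ 2 = 1 - Real.sin t ^ 2 := by linarith
  simp only [Pi.pow_apply]
  push_cast
  linear_combination (3 * Real.sin t ^ 2) * h'

theorem lipschitzWith_sinCubeCosDeriv (n : ℕ) : LipschitzWith 22 (sinCubeCosDeriv n) := by
  have h : LipschitzWith 22 (fun t => 3 * Real.sin t ^ 2 - 4 * Real.sin t ^ 4) := by
    refine lipschitzWith_of_nnnorm_deriv_le (by fun_prop) fun t => ?_
    have : HasDerivAt (fun t => 3 * Real.sin t ^ 2 - 4 * Real.sin t ^ 4)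
        ((6 * Real.sin t - 16 * Real.sin t ^ 3) * Real.cos t) t := by
      refine ((((Real.hasDerivAt_sin t).pow 2).const_mul 3).sub
        (((Real.hasDerivAt_sin t).pow 4).const_mul 4)).congr_deriv ?_
      push_cast
      ring
    rw [this.deriv, ← NNReal.coe_le_coe, coe_nnnorm, Real.norm_eq_abs, abs_mul]
    have h₁ := Real.abs_sin_le_one t
    have h₂ := Real.abs_cos_le_one t
    have h₃ : |Real.sin t| ^ 3 ≤ 1 := pow_le_one₀ (abs_nonneg _) h₁
    have h₄ : |6 * Real.sin t - 16 * Real.sin t ^ 3| ≤ 22 := by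
      refine (abs_sub _ _).trans ?_
      rw [abs_mul, abs_mul, abs_pow, abs_of_pos (by norm_num : (0 : ℝ) < 6),
        abs_of_pos (by norm_num : (0 : ℝ) < 16)]
      linarith
    calc _ ≤ (22 : ℝ) * 1 := mul_le_mul h₄ h₂ (abs_nonneg _) (by norm_num)
      _ = _ := by norm_num
  have h' := h.comp (lipschitzWith_clampPi n)
  rw [mul_one] at h'
  exact h'

theorem integral_sinCubeCosDeriv (n : ℕ) (t : ℝ) :
    ∫ r in (0 : ℝ)..t, sinCubeCosDeriv n r = sinCubeCosProfile n t := by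
  have hn : 0 ≤ n * Real.pi := by positivity
  have hint : ∀ a b, IntervalIntegrable (sinCubeCosDeriv n) volume a b := fun a b =>
    (lipschitzWith_sinCubeCosDeriv n).continuous.intervalIntegrable a b
  have inside : ∀ t, 0 ≤ t → t ≤ n * Real.pi →
      ∫ r in (0 : ℝ)..t, sinCubeCosDeriv n r = sinCubeCosProfile n t := by
    intro t h₀ h₁
    have : ∫ r in (0 : ℝ)..t, sinCubeCosDeriv n r =
        ∫ r in (0 : ℝ)..t, (3 * Real.sin r ^ 2 - 4 * Real.sin r ^ 4) := by
      refine intervalIntegral.integral_congr fun r hr => ?_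
      rw [uIcc_of_le h₀] at hr
      simp only [sinCubeCosDeriv, clampPi_of_mem hr.1 (hr.2.trans h₁)]
    rw [this, intervalIntegral.integral_eq_sub_of_hasDerivAt
      (fun r _ => hasDerivAt_sin_cube_mul_cos r)
      ((by fun_prop : Continuous _).intervalIntegrable _ _)]
    simp [sinCubeCosProfile, clampPi_of_mem h₀ h₁]
  rcases le_or_gt t 0 with h | h
  · rw [sinCubeCosProfile_of_notMem fun h' => h.not_gt h'.1]
    rw [intervalIntegral.integral_congr (g := fun _ => (0 : ℝ))]
    · simp
    · intro r hr
      rw [uIcc_of_ge h] at hr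
      exact sinCubeCosDeriv_of_notMem fun h' => hr.2.not_gt h'.1
  rcases le_total t (n * Real.pi) with h₁ | h₁
  · exact inside t h.le h₁
  · rw [sinCubeCosProfile_of_notMem fun h' => h₁.not_gt h'.2,
      ← intervalIntegral.integral_add_adjacent_intervals (hint 0 (n * Real.pi)) (hint _ t),
      inside _ hn le_rfl, sinCubeCosProfile_of_notMem fun h' => lt_irrefl _ h'.2, zero_add]
    rw [intervalIntegral.integral_congr (g := fun _ => (0 : ℝ))]
    · simp
    · intro r hr
      rw [uIcc_of_le h₁] at hr
      exact sinCubeCosDeriv_of_notMem fun h' => hr.1.not_gt h'.2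

/-- Recovering the profile as the integral of its continuous derivative avoids a separate discussion
of the junction points. The factor `sin³` makes that derivative vanish, and stay Lipschitz, at the
ends of the interval. -/
theorem hasDerivAt_sinCubeCosProfile (n : ℕ) (t : ℝ) :
    HasDerivAt (sinCubeCosProfile n) (sinCubeCosDeriv n t) t := by
  have hc := (lipschitzWith_sinCubeCosDeriv n).continuous
  rw [← funext (integral_sinCubeCosDeriv n)]
  exact intervalIntegral.integral_hasDerivAt_right (hc.intervalIntegrable _ _)
    (hc.stronglyMeasurableAtFilter _ _) hc.continuousAt

theorem lipschitzWith_sinCubeCosProfile (n : ℕ) : LipschitzWith 1 (sinCubeCosProfile n) := by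
  refine lipschitzWith_of_nnnorm_deriv_le
    (fun t => (hasDerivAt_sinCubeCosProfile n t).differentiableAt) fun t => ?_
  rw [(hasDerivAt_sinCubeCosProfile n t).deriv]
  exact abs_sinCubeCosDeriv_le_one n t

theorem integral_abs_sinCubeCosDeriv_le (n : ℕ) : ∫ t, |sinCubeCosDeriv n t| ≤ n * Real.pi := by
  have hn : 0 ≤ n * Real.pi := by positivity
  rw [← intervalIntegral.integral_eq_integral_of_support_subset (a := 0) (b := n * Real.pi)]
  · have h := intervalIntegral.norm_integral_le_of_norm_le_const (a := 0) (b := n * Real.pi)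
      (f := fun t => |sinCubeCosDeriv n t|) (C := 1) fun t _ => by
        simpa using abs_sinCubeCosDeriv_le_one n t
    rw [sub_zero, abs_of_nonneg hn, one_mul] at h
    exact (Real.le_norm_self _).trans h
  · intro t ht
    by_contra h
    exact ht (by
      simp only [abs_eq_zero]
      exact sinCubeCosDeriv_of_notMem fun h' => h (Ioo_subset_Ioc_self h'))

/-- By parts the integral is that of `-2 sin⁴ cos²`, of mean `-1/8`. The linear growth in `n` is
what makes the variation large; the negative signs of the two one-dimensional factors cancel in the
product. -/
theorem integral_sinSqProfile_mul_sinCubeCosDeriv (n : ℕ) :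
    ∫ t, sinSqProfile n t * sinCubeCosDeriv n t = -(n * Real.pi / 8) := by
  have hn : 0 ≤ n * Real.pi := by positivity
  rw [← intervalIntegral.integral_eq_integral_of_support_subset (a := 0) (b := n * Real.pi)]
  · have hd : ∀ t : ℝ, HasDerivAt (fun t => Real.sin t ^ 5 * Real.cos t -
        (t / 8 - Real.sin t * Real.cos t / 8 - Real.sin t ^ 3 * Real.cos t / 12 +
          Real.sin t ^ 5 * Real.cos t / 3))
        (Real.sin t ^ 2 * (3 * Real.sin t ^ 2 - 4 * Real.sin t ^ 4)) t := by
      intro t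
      have hs := Real.hasDerivAt_sin t
      have hc := Real.hasDerivAt_cos t
      refine (((hs.pow 5).mul hc).sub (((((hasDerivAt_id t).div_const 8).sub
        ((hs.mul hc).div_const 8)).sub (((hs.pow 3).mul hc).div_const 12)).add
        (((hs.pow 5).mul hc).div_const 3))).congr_deriv ?_
      have h' : Real.cos t ^ 2 = 1 - Real.sin t ^ 2 := by
        have := Real.sin_sq_add_cos_sq t
        linarith
      simp only [Pi.pow_apply]
      push_cast
      linear_combination (5 * Real.sin t ^ 4 + 1 / 8 + Real.sin t ^ 2 / 4
        - 5 / 3 * Real.sin t ^ 4) * h'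
    have e : ∫ t in (0 : ℝ)..(n * Real.pi), sinSqProfile n t * sinCubeCosDeriv n t =
        ∫ t in (0 : ℝ)..(n * Real.pi),
          Real.sin t ^ 2 * (3 * Real.sin t ^ 2 - 4 * Real.sin t ^ 4) := by
      refine intervalIntegral.integral_congr fun r hr => ?_
      rw [uIcc_of_le hn] at hr
      simp only [sinSqProfile, sinCubeCosDeriv, clampPi_of_mem hr.1 hr.2]
    rw [e, intervalIntegral.integral_eq_sub_of_hasDerivAt (fun r _ => hd r)
      ((by fun_prop : Continuous _).intervalIntegrable _ _)]
    simp [Real.sin_nat_mul_pi]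
  · intro t ht
    by_contra h
    exact ht (by
      simp only
      rw [sinCubeCosDeriv_of_notMem fun h' => h (Ioo_subset_Ioc_self h'), mul_zero])

end Profiles

/-! ### Functions and test fields of product form on the plane. -/

section ProductFunctions

theorem integral_mul_euc_two (g h : ℝ → ℝ) :
    ∫ x : Euc 2, g (x 0) * h (x 1) = (∫ r, g r) * ∫ r, h r := by
  have e := (PiLp.volume_preserving_ofLp (Fin 2)).integral_comp
    (MeasurableEquiv.toLp 2 (Fin 2 → ℝ)).symm.measurableEmbedding
    (fun x : Fin 2 → ℝ => g (x 0) * h (x 1))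
  refine e.trans ?_
  have := integral_fintype_prod_volume_eq_prod (ι := Fin 2) (E := fun _ => ℝ)
    (fun i => if i = 0 then g else h)
  simpa [Fin.prod_univ_two] using this

theorem isCompact_rectangle {I J : Set ℝ} (hI : IsCompact I) (hJ : IsCompact J) :
    IsCompact {x : Euc 2 | x 0 ∈ I ∧ x 1 ∈ J} := by
  have h : IsCompact (univ.pi fun i : Fin 2 => if i = 0 then I else J) :=
    isCompact_univ_pi fun i => by
      split_ifs
      · exact hI
      · exact hJ
  have h' := (EuclideanSpace.equiv (Fin 2) ℝ).toHomeomorph.isCompact_preimage.2 h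
  convert h' using 1
  ext x
  simp [Fin.forall_fin_two]

theorem hasCompactSupport_mul {I J : Set ℝ} (hI : IsCompact I) (hJ : IsCompact J) {g h : ℝ → ℝ}
    (hg : ∀ r ∉ I, g r = 0) (hh : ∀ r ∉ J, h r = 0) :
    HasCompactSupport fun x : Euc 2 => g (x 0) * h (x 1) := by
  refine HasCompactSupport.of_support_subset_isCompact (isCompact_rectangle hI hJ) fun x hx => ?_
  by_contra hx'
  rcases not_and_or.1 hx' with h' | h'
  · exact hx (by simp [hg _ h'])
  · exact hx (by simp [hh _ h'])

theorem lipschitzWith_mul_euc_two {g h : ℝ → ℝ} {Kg Kh C D : ℝ≥0} (hg : LipschitzWith Kg g)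
    (hh : LipschitzWith Kh h) (hC : ∀ r, |g r| ≤ C) (hD : ∀ r, |h r| ≤ D) :
    LipschitzWith (Kg * D + C * Kh) fun x : Euc 2 => g (x 0) * h (x 1) := by
  refine LipschitzWith.of_dist_le_mul fun x y => ?_
  have hc : ∀ i, dist (x i) (y i) ≤ dist x y := fun i => by
    simpa [dist_eq_norm] using abs_apply_le_norm (x - y) i
  have h₁ := (hg.dist_le_mul (x 0) (y 0)).trans (mul_le_mul_of_nonneg_left (hc 0) Kg.2)
  have h₂ := (hh.dist_le_mul (x 1) (y 1)).trans (mul_le_mul_of_nonneg_left (hc 1) Kh.2)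
  have e : g (x 0) * h (x 1) - g (y 0) * h (y 1) =
      (g (x 0) - g (y 0)) * h (x 1) + g (y 0) * (h (x 1) - h (y 1)) := by ring
  rw [Real.dist_eq] at h₁ h₂ ⊢
  rw [e]
  refine (abs_add_le _ _).trans ?_
  rw [abs_mul, abs_mul]
  have h₃ := mul_le_mul h₁ (hD (x 1)) (abs_nonneg _) (mul_nonneg Kg.2 dist_nonneg)
  have h₄ := mul_le_mul (hC (y 0)) h₂ (abs_nonneg _) C.2
  push_cast
  change _ ≤ (Kg : ℝ) * dist x y * D at h₃
  change _ ≤ (C : ℝ) * (Kh * dist x y) at h₄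
  linarith

theorem hasFDerivAt_mul_euc_two {g h : ℝ → ℝ} {g' h' : ℝ} {x : Euc 2}
    (hg : HasDerivAt g g' (x 0)) (hh : HasDerivAt h h' (x 1)) :
    HasFDerivAt (fun x : Euc 2 => g (x 0) * h (x 1))
      (g (x 0) • h' • EuclideanSpace.proj (𝕜 := ℝ) (1 : Fin 2) +
        h (x 1) • g' • EuclideanSpace.proj (𝕜 := ℝ) (0 : Fin 2)) x := by
  have h₀ : HasFDerivAt (fun x : Euc 2 => g (x 0)) (g' • EuclideanSpace.proj (𝕜 := ℝ) (0 : Fin 2)) x :=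
    hg.comp_hasFDerivAt x (EuclideanSpace.proj (𝕜 := ℝ) (0 : Fin 2)).hasFDerivAt
  have h₁ : HasFDerivAt (fun x : Euc 2 => h (x 1)) (h' • EuclideanSpace.proj (𝕜 := ℝ) (1 : Fin 2)) x :=
    hh.comp_hasFDerivAt x (EuclideanSpace.proj (𝕜 := ℝ) (1 : Fin 2)).hasFDerivAt
  exact h₀.mul h₁

/-- The field with rows `0` and `(f, 0)`. -/
noncomputable def rowField (f : Euc 2 → ℝ) (i : Fin 2) (x : Euc 2) : Euc 2 :=
  if i = 1 then f x • EuclideanSpace.single 0 1 else 0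

theorem isTestField_rowField {f : Euc 2 → ℝ} {Ω : Set (Euc 2)} (hf : ContDiff ℝ 1 f)
    (hc : HasCompactSupport f) (hs : tsupport f ⊆ Ω) (h1 : ∀ x, |f x| ≤ 1) :
    IsTestField Ω (rowField f) := by
  have hzero : rowField f 0 = 0 := by ext x i; simp [rowField]
  have hone : rowField f 1 = fun x => f x • EuclideanSpace.single 0 1 := by ext x i; simp [rowField]
  refine ⟨fun i => ?_, fun x => ?_⟩
  · fin_cases i
    · change ContDiff ℝ 1 (rowField f 0) ∧ HasCompactSupport (rowField f 0) ∧
        tsupport (rowField f 0) ⊆ Ω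
      rw [hzero]
      exact ⟨contDiff_const, HasCompactSupport.zero, by simp [tsupport]⟩
    · change ContDiff ℝ 1 (rowField f 1) ∧ HasCompactSupport (rowField f 1) ∧
        tsupport (rowField f 1) ⊆ Ω
      rw [hone]
      exact ⟨hf.smul contDiff_const, hc.smul_right, (tsupport_smul_subset_left f _).trans hs⟩
  · rw [Fin.sum_univ_two, hzero, hone]
    simpa [norm_smul] using h1 x

theorem sum_mul_divergence_rowField {f : Euc 2 → ℝ} {x : Euc 2} (hf : DifferentiableAt ℝ f x)
    (p : Euc 2) : ∑ i, p i * divergence (rowField f i) x =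
      p 1 * fderiv ℝ f x (EuclideanSpace.single 0 1) := by
  have hzero : rowField f 0 = 0 := by ext x i; simp [rowField]
  have hone : rowField f 1 = fun x => f x • EuclideanSpace.single 0 1 := by ext x i; simp [rowField]
  rw [Fin.sum_univ_two, hzero, hone]
  simp [divergence, fderiv_smul_const hf]

end ProductFunctions

/-! ### Lower bound of the variation by duality. -/

section VariationLowerBound

/-- Twofold integration by parts against a test function of product form. -/
theorem ofReal_integral_le_variation {w : Euc 2 → ℝ} {K : ℝ≥0} (hw : LipschitzWith K w)
    {F : Euc 2 → Euc 2} {κ : ℝ} (hF : ∀ x, F x 1 = κ * gradient w x 1) {Ω : Set (Euc 2)}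
    {I J : Set ℝ} (hI : IsCompact I) (hJ : IsCompact J)
    (hΩ : {x : Euc 2 | x 0 ∈ I ∧ x 1 ∈ J} ⊆ Ω)
    {α α' β β' : ℝ → ℝ} (hα : ∀ r, HasDerivAt α (α' r) r) (hβ : ∀ r, HasDerivAt β (β' r) r)
    {Kα Kβ C : ℝ≥0} (hα' : LipschitzWith Kα α') (hβ' : Continuous β') (hβK : LipschitzWith Kβ β)
    (hα'C : ∀ r, |α' r| ≤ C) (hα1 : ∀ r, |α r| ≤ 1) (hβ1 : ∀ r, |β r| ≤ 1)
    (hαI : ∀ r ∉ I, α r = 0) (hα'I : ∀ r ∉ I, α' r = 0) (hβJ : ∀ r ∉ J, β r = 0) :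
    ENNReal.ofReal (κ * ∫ x : Euc 2, α' (x 0) * β' (x 1) * w x) ≤ variation F Ω := by
  -- Placed in the row of `F x 1 = κ ∂₁w`, this function tests the mixed derivative `∂₀∂₁w`. Its
  -- minus sign cancels the one from integrating `∂₁` by parts, which is legitimate because `w` and
  -- `g` are Lipschitz and `g` has compact support.
  set f : Euc 2 → ℝ := fun x => -α (x 0) * β (x 1) with hf
  have hαn : ∀ r, HasDerivAt (fun r => -α r) (-α' r) r := fun r => (hα r).neg
  have hC1 : ∀ g g' : ℝ → ℝ, (∀ r, HasDerivAt g (g' r) r) → Continuous g' → ContDiff ℝ 1 g := by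
    intro g g' hg hg'
    rw [contDiff_one_iff_deriv]
    refine ⟨fun r => (hg r).differentiableAt, ?_⟩
    rwa [funext fun r => (hg r).deriv]
  have hcoord : ∀ i : Fin 2, ContDiff ℝ 1 (fun x : Euc 2 => x i) := fun i =>
    (EuclideanSpace.proj (𝕜 := ℝ) i).contDiff
  have hfC : ContDiff ℝ 1 f :=
    ((hC1 _ _ hαn hα'.continuous.neg).comp (hcoord 0)).mul ((hC1 _ _ hβ hβ').comp (hcoord 1))
  have hfc : HasCompactSupport f :=
    hasCompactSupport_mul (g := fun r => -α r) (h := β) hI hJ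
      (fun r hr => by rw [hαI r hr, neg_zero]) hβJ
  have hfs : tsupport f ⊆ Ω := by
    refine (closure_minimal (fun x hx => ?_) (isCompact_rectangle hI hJ).isClosed).trans hΩ
    by_contra hx'
    rcases not_and_or.1 hx' with h' | h'
    · exact hx (by simp [hf, hαI _ h'])
    · exact hx (by simp [hf, hβJ _ h'])
  have hf1 : ∀ x, |f x| ≤ 1 := fun x => by
    rw [hf, abs_mul, abs_neg]
    exact mul_le_one₀ (hα1 _) (abs_nonneg _) (hβ1 _)
  refine le_iSup₂_of_le (rowField f) (isTestField_rowField hfC hfc hfs hf1)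
    (ENNReal.ofReal_le_ofReal (le_of_eq ?_))
  set g : Euc 2 → ℝ := fun x => α' (x 0) * β (x 1) with hg
  have hdiv : ∀ x, ∑ i, F x i * divergence (rowField f i) x = -κ * (gradient w x 1 * g x) := by
    intro x
    have hfd := hasFDerivAt_mul_euc_two (hαn (x 0)) (hβ (x 1))
    have hfe : fderiv ℝ f x (EuclideanSpace.single 0 1) = -g x := by
      rw [hfd.fderiv]
      simp [hg, mul_comm]
    rw [sum_mul_divergence_rowField hfd.differentiableAt, hfe, hF]
    ring
  have hae : ∀ᵐ x, gradient w x 1 * g x =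
      lineDeriv ℝ w x (EuclideanSpace.single 1 1) * g x := by
    filter_upwards [hw.ae_differentiableAt] with x hx
    rw [hx.lineDeriv_eq_fderiv, ← inner_gradient_left, inner_euc_two]
    simp
  have hgL : LipschitzWith _ g := lipschitzWith_mul_euc_two hα' hβK hα'C (D := 1) (by simpa using hβ1)
  have hgc : HasCompactSupport g := hasCompactSupport_mul hI hJ hα'I hβJ
  have hline : ∀ x, lineDeriv ℝ g x (-EuclideanSpace.single 1 1) = -(α' (x 0) * β' (x 1)) := by
    intro x
    have hd : HasDerivAt (fun t : ℝ => α' (x 0) * β (x 1 - t)) (α' (x 0) * -β' (x 1)) 0 := by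
      have h₁ : HasDerivAt (fun t : ℝ => x 1 - t) (-1) 0 := by
        simpa using (hasDerivAt_id (0 : ℝ)).const_sub (x 1)
      have h₂ : HasDerivAt β (β' (x 1)) (x 1 - 0) := by simpa using hβ (x 1)
      simpa using (h₂.comp 0 h₁).const_mul (α' (x 0))
    have e : (fun t : ℝ => g (x + t • -EuclideanSpace.single 1 1)) =
        fun t : ℝ => α' (x 0) * β (x 1 - t) := by
      ext t
      simp [hg, sub_eq_add_neg]
    rw [lineDeriv, e, hd.deriv, mul_neg]
  rw [integral_congr_ae (Eventually.of_forall hdiv), integral_const_mul, integral_congr_ae hae,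
    hw.integral_lineDeriv_mul_eq hgL hgc]
  simp_rw [hline, neg_mul]
  rw [integral_neg]
  ring

/-- If `w` is uniformly close to a product function, its integral against a product function is
close to a product of one-dimensional integrals. -/
theorem integral_mul_ge_of_abs_sub_le {w : Euc 2 → ℝ} (hw : Continuous w) {I J : Set ℝ}
    (hI : IsCompact I) (hJ : IsCompact J) {g h σ ρ : ℝ → ℝ} (hg : Continuous g)
    (hh : Continuous h) (hσ : Continuous σ) (hρ : Continuous ρ) (hgI : ∀ r ∉ I, g r = 0)
    (hhJ : ∀ r ∉ J, h r = 0) {δ : ℝ}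
    (hle : ∀ x : Euc 2, x 0 ∈ I → |w x - σ (x 0) * ρ (x 1)| ≤ δ) :
    (∫ r, σ r * g r) * (∫ r, ρ r * h r) - δ * ((∫ r, |g r|) * ∫ r, |h r|) ≤
      ∫ x : Euc 2, g (x 0) * h (x 1) * w x := by
  have hcoord : ∀ i : Fin 2, Continuous (fun x : Euc 2 => x i) := fun i =>
    (EuclideanSpace.proj (𝕜 := ℝ) i).continuous
  have hgh : Continuous fun x : Euc 2 => g (x 0) * h (x 1) :=
    (hg.comp (hcoord 0)).mul (hh.comp (hcoord 1))
  have hσρ : Continuous fun x : Euc 2 => σ (x 0) * ρ (x 1) :=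
    (hσ.comp (hcoord 0)).mul (hρ.comp (hcoord 1))
  have hcs : HasCompactSupport fun x : Euc 2 => g (x 0) * h (x 1) :=
    hasCompactSupport_mul hI hJ hgI hhJ
  have i₁ : Integrable fun x : Euc 2 => g (x 0) * h (x 1) * w x :=
    (hgh.mul hw).integrable_of_hasCompactSupport hcs.mul_right
  have i₂ : Integrable fun x : Euc 2 => g (x 0) * h (x 1) * (σ (x 0) * ρ (x 1)) :=
    (hgh.mul hσρ).integrable_of_hasCompactSupport hcs.mul_right
  have i₃ : Integrable fun x : Euc 2 => |g (x 0)| * |h (x 1)| := by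
    simpa only [abs_mul] using (hgh.integrable_of_hasCompactSupport hcs).abs
  rw [← integral_mul_euc_two (fun r => σ r * g r) (fun r => ρ r * h r),
    ← integral_mul_euc_two (fun r => |g r|) (fun r => |h r|), ← integral_const_mul]
  have i₂' : Integrable fun x : Euc 2 => σ (x 0) * g (x 0) * (ρ (x 1) * h (x 1)) := by
    refine i₂.congr (Eventually.of_forall fun x => ?_)
    dsimp only
    ring
  rw [← integral_sub i₂' (i₃.const_mul δ)]
  refine integral_mono (i₂'.sub (i₃.const_mul δ)) i₁ fun x => ?_
  have key : |g (x 0) * h (x 1) * (w x - σ (x 0) * ρ (x 1))| ≤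
      δ * (|g (x 0)| * |h (x 1)|) := by
    rw [abs_mul, abs_mul, mul_comm]
    by_cases hx : x 0 ∈ I
    · exact mul_le_mul_of_nonneg_right (hle x hx) (by positivity)
    · simp [hgI _ hx]
  have := (abs_le.1 key).1
  dsimp only
  linarith

theorem integral_mul_comp_affine {a : ℝ} (ha : 0 < a) (s : ℝ) (f : ℝ → ℝ) :
    ∫ r, a * f (a * (r - s)) = ∫ r, f r := by
  rw [integral_const_mul, integral_sub_right_eq_self (fun r => f (a * r)),
    Measure.integral_comp_mul_left, abs_of_pos (inv_pos.2 ha), smul_eq_mul, ← mul_assoc,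
    mul_inv_cancel₀ ha.ne', one_mul]

theorem lipschitzWith_comp_affine {f : ℝ → ℝ} {K : ℝ≥0} (hf : LipschitzWith K f) (a s : ℝ) :
    LipschitzWith (K * ‖a‖₊) fun r => f (a * (r - s)) := by
  refine hf.comp (LipschitzWith.of_dist_le_mul fun x y => ?_)
  rw [Real.dist_eq, Real.dist_eq, ← mul_sub, abs_mul, sub_sub_sub_cancel_right]
  rfl

/-- A function which is close to a rapidly oscillating product has a gradient of large
variation. -/
theorem ofReal_le_variation_of_close {w : Euc 2 → ℝ} {K : ℝ≥0} (hw : LipschitzWith K w)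
    {F : Euc 2 → Euc 2} {κ : ℝ} (hκ : 1 ≤ κ) (hF : ∀ x, F x 1 = κ * gradient w x 1)
    {Ω : Set (Euc 2)} {A a s b c : ℝ} {n m : ℕ} (hA : 0 ≤ A) (ha : 0 < a) (hb : 0 < b)
    (hΩ : {x : Euc 2 | x 0 ∈ Icc s (s + n * Real.pi / a) ∧
      x 1 ∈ Icc c (c + m * Real.pi / b)} ⊆ Ω)
    (hle : ∀ x : Euc 2, x 0 ∈ Icc s (s + n * Real.pi / a) →
      |w x - A * sinSqProfile n (a * (x 0 - s)) * sinSqProfile m (b * (x 1 - c))| ≤ A / 128) :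
    ENNReal.ofReal (A * (n * m) * Real.pi ^ 2 / 128) ≤ variation F Ω := by
  have hmem : ∀ {a s r : ℝ} {n : ℕ}, 0 < a → r ∉ Icc s (s + n * Real.pi / a) →
      a * (r - s) ∉ Ioo 0 (n * Real.pi) := by
    intro a s r n ha hr h
    refine hr ⟨?_, ?_⟩
    · have := pos_of_mul_pos_right h.1 ha.le
      linarith
    · rw [← sub_le_iff_le_add', le_div_iff₀ ha, mul_comm]
      exact h.2.le
  have hderiv : ∀ (a s : ℝ) (n : ℕ) (r : ℝ),
      HasDerivAt (fun r => sinCubeCosProfile n (a * (r - s)))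
        (a * sinCubeCosDeriv n (a * (r - s))) r := by
    intro a s n r
    have h₁ : HasDerivAt (fun r : ℝ => a * (r - s)) a r := by
      simpa using ((hasDerivAt_id r).sub_const s).const_mul a
    rw [mul_comm]
    exact (hasDerivAt_sinCubeCosProfile n (a * (r - s))).comp r h₁
  have hcont : ∀ (a s : ℝ) (n : ℕ), LipschitzWith (‖a‖₊ * (22 * ‖a‖₊))
      fun r => a * sinCubeCosDeriv n (a * (r - s)) := fun a s n =>
    (lipschitzWith_smul a).comp (lipschitzWith_comp_affine (lipschitzWith_sinCubeCosDeriv n) a s)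
  have hbound : ∀ r, |a * sinCubeCosDeriv n (a * (r - s))| ≤ ‖a‖₊ := fun r => by
    rw [abs_mul]
    exact mul_le_of_le_one_right (abs_nonneg _) (abs_sinCubeCosDeriv_le_one _ _)
  have hS : ∀ (a s : ℝ) (n : ℕ), Continuous fun r => sinSqProfile n (a * (r - s)) :=
    fun a s n => (lipschitzWith_comp_affine (lipschitzWith_sinSqProfile n) a s).continuous
  have hvar := ofReal_integral_le_variation hw hF isCompact_Icc isCompact_Icc hΩ
    (hderiv a s n) (hderiv b c m) (hcont a s n) (hcont b c m).continuous
    (lipschitzWith_comp_affine (lipschitzWith_sinCubeCosProfile m) b c) hbound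
    (fun r => abs_sinCubeCosProfile_le_one _ _) (fun r => abs_sinCubeCosProfile_le_one _ _)
    (fun r hr => sinCubeCosProfile_of_notMem (hmem ha hr))
    (fun r hr => by rw [sinCubeCosDeriv_of_notMem (hmem ha hr), mul_zero])
    (fun r hr => sinCubeCosProfile_of_notMem (hmem hb hr))
  refine le_trans (ENNReal.ofReal_le_ofReal ?_) hvar
  have hint := integral_mul_ge_of_abs_sub_le hw.continuous isCompact_Icc isCompact_Icc
    (hcont a s n).continuous (hcont b c m).continuous (σ := fun r => A * sinSqProfile n (a * (r - s)))
    (continuous_const.mul (hS a s n)) (hS b c m)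
    (fun r hr => by rw [sinCubeCosDeriv_of_notMem (hmem ha hr), mul_zero])
    (fun r hr => by rw [sinCubeCosDeriv_of_notMem (hmem hb hr), mul_zero]) hle
  have e₁ : ∀ (a s : ℝ) (n : ℕ), 0 < a →
      ∫ r, sinSqProfile n (a * (r - s)) * (a * sinCubeCosDeriv n (a * (r - s))) =
        -(n * Real.pi / 8) := by
    intro a s n ha
    rw [← integral_sinSqProfile_mul_sinCubeCosDeriv,
      ← integral_mul_comp_affine ha s fun r => sinSqProfile n r * sinCubeCosDeriv n r]
    congr 1
    ext r
    ring
  have e₂ : ∀ (a s : ℝ) (n : ℕ), 0 < a →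
      ∫ r, |a * sinCubeCosDeriv n (a * (r - s))| ≤ n * Real.pi := by
    intro a s n ha
    simp_rw [abs_mul, abs_of_pos ha]
    rw [integral_mul_comp_affine ha s (fun r => |sinCubeCosDeriv n r|)]
    exact integral_abs_sinCubeCosDeriv_le n
  have e₃ : ∫ r, A * sinSqProfile n (a * (r - s)) * (a * sinCubeCosDeriv n (a * (r - s))) =
      A * -(n * Real.pi / 8) := by
    rw [← e₁ a s n ha, ← integral_const_mul]
    simp_rw [mul_assoc]
  rw [e₃, e₁ b c m hb] at hint
  have e₄ := mul_le_mul (e₂ a s n ha) (e₂ b c m hb)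
    (integral_nonneg fun _ => abs_nonneg _) (by positivity)
  have e₅ := mul_le_mul_of_nonneg_left e₄ (by positivity : 0 ≤ A / 128)
  have e₆ : A * (n * m) * Real.pi ^ 2 / 128 ≤ ∫ x : Euc 2,
      a * sinCubeCosDeriv n (a * (x 0 - s)) * (b * sinCubeCosDeriv m (b * (x 1 - c))) * w x := by
    -- The main term is `A n m π² / 64`; the admissible error `A / 128` costs exactly half of it.
    refine le_trans (le_of_eq ?_) (le_trans (sub_le_sub_left e₅ _) hint)
    ring
  have e₇ : 0 ≤ A * (n * m) * Real.pi ^ 2 / 128 := by positivity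
  exact e₆.trans (le_mul_of_one_le_left (e₇.trans e₆) hκ)

end VariationLowerBound

/-! ### The oscillating datum and the variation of the solution. -/

section Construction

/-- The width `4^{-(k+1)}` of the `k`-th strip, which is also the abscissa of its left side. -/
noncomputable def stripWidth (k : ℕ) : ℝ := (1 / 4) ^ (k + 1)

/-- The inverse `16^{k+1} (k+1)` of the scale parameter in the `k`-th strip. -/
def stripScale (k : ℕ) : ℕ := 16 ^ (k + 1) * (k + 1)

/-- The horizontal frequency in the `k`-th strip. -/
noncomputable def stripFreqX (k : ℕ) : ℝ := Real.pi * stripScale k ^ 3 / stripWidth k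

/-- The vertical frequency in the `k`-th strip. -/
noncomputable def stripFreqY (k : ℕ) : ℝ := 2 * Real.pi * stripScale k ^ 2

/-- The amplitude in the `k`-th strip. -/
noncomputable def stripAmplitude (k : ℕ) : ℝ := stripWidth k ^ 2 / (8192 * stripScale k ^ 4)

/-- The oscillation carried by the `k`-th strip. -/
noncomputable def stripWave (k : ℕ) (x : Euc 2) : ℝ :=
  stripAmplitude k * sinSqProfile (stripScale k ^ 3) (stripFreqX k * (x 0 - stripWidth k)) *
    sinSqProfile (stripScale k ^ 2) (stripFreqY k * (x 1 - 1 / 4))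

/-- The initial datum. -/
noncomputable def oscillatingDatum (x : Euc 2) : ℝ := ⨆ k, stripWave k x

theorem stripWidth_pos (k : ℕ) : 0 < stripWidth k := by unfold stripWidth; positivity

theorem stripWidth_le (k : ℕ) : stripWidth k ≤ 1 / 4 :=
  pow_le_of_le_one (by norm_num) (by norm_num) (Nat.succ_ne_zero k)

theorem two_mul_stripWidth_le {j k : ℕ} (h : j < k) : 2 * stripWidth k ≤ stripWidth j := by
  have h₁ : stripWidth k ≤ (1 / 4 : ℝ) ^ (j + 1 + 1) :=
    pow_le_pow_of_le_one (by norm_num) (by norm_num) (by omega)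
  have h₂ : (1 / 4 : ℝ) ^ (j + 1 + 1) = stripWidth j * (1 / 4) := pow_succ _ _
  have := stripWidth_pos j
  linarith

theorem one_le_stripScale (k : ℕ) : (1 : ℝ) ≤ stripScale k := by
  have : 1 ≤ stripScale k := Nat.one_le_iff_ne_zero.2 (by unfold stripScale; positivity)
  exact_mod_cast this

theorem stripWidth_sq_mul_stripScale (k : ℕ) : stripWidth k ^ 2 * stripScale k = k + 1 := by
  unfold stripWidth stripScale
  push_cast
  rw [← pow_mul, mul_comm (k + 1) 2, pow_mul, ← mul_assoc, ← mul_pow]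
  norm_num

theorem stripFreqX_pos (k : ℕ) : 0 < stripFreqX k := by
  have h₁ := stripWidth_pos k
  have h₂ := zero_lt_one.trans_le (one_le_stripScale k)
  unfold stripFreqX
  positivity

theorem stripFreqY_pos (k : ℕ) : 0 < stripFreqY k := by
  have h₂ := zero_lt_one.trans_le (one_le_stripScale k)
  unfold stripFreqY
  positivity

theorem stripAmplitude_pos (k : ℕ) : 0 < stripAmplitude k := by
  have h₁ := stripWidth_pos k
  have h₂ := zero_lt_one.trans_le (one_le_stripScale k)
  unfold stripAmplitude
  positivity

theorem stripScale_mul_pi_div_stripFreqX (k : ℕ) :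
    ((stripScale k ^ 3 : ℕ) : ℝ) * Real.pi / stripFreqX k = stripWidth k := by
  have h₁ := (stripWidth_pos k).ne'
  have h₂ := (zero_lt_one.trans_le (one_le_stripScale k)).ne'
  have h₃ := Real.pi_ne_zero
  unfold stripFreqX
  push_cast
  field_simp

theorem stripScale_mul_pi_div_stripFreqY (k : ℕ) :
    ((stripScale k ^ 2 : ℕ) : ℝ) * Real.pi / stripFreqY k = 1 / 2 := by
  have h₂ := (zero_lt_one.trans_le (one_le_stripScale k)).ne'
  have h₃ := Real.pi_ne_zero
  unfold stripFreqY
  push_cast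
  field_simp

theorem stripAmplitude_mul_stripFreqX (k : ℕ) :
    stripAmplitude k * stripFreqX k = Real.pi * stripWidth k / (8192 * stripScale k) := by
  have h₁ := (stripWidth_pos k).ne'
  have h₂ := (zero_lt_one.trans_le (one_le_stripScale k)).ne'
  unfold stripAmplitude stripFreqX
  field_simp

theorem stripAmplitude_mul_stripFreqY (k : ℕ) :
    stripAmplitude k * stripFreqY k =
      2 * Real.pi * stripWidth k ^ 2 / (8192 * stripScale k ^ 2) := by
  have h₂ := (zero_lt_one.trans_le (one_le_stripScale k)).ne'
  unfold stripAmplitude stripFreqY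
  field_simp

theorem stripAmplitude_le_one (k : ℕ) : stripAmplitude k ≤ 1 := by
  have h₀ := (stripWidth_pos k).le
  have h₁ : stripWidth k ^ 2 ≤ 1 := pow_le_one₀ h₀ ((stripWidth_le k).trans (by norm_num))
  have h₂ : 1 ≤ (stripScale k : ℝ) ^ 4 := one_le_pow₀ (one_le_stripScale k)
  unfold stripAmplitude
  rw [div_le_one (by positivity)]
  linarith

theorem stripAmplitude_mul_stripFreqX_le_one (k : ℕ) : stripAmplitude k * stripFreqX k ≤ 1 := by
  have h₀ := stripWidth_pos k
  have h₁ := stripWidth_le k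
  have h₂ := one_le_stripScale k
  rw [stripAmplitude_mul_stripFreqX, div_le_one (by positivity)]
  nlinarith [Real.pi_pos, Real.pi_lt_four]

theorem stripAmplitude_mul_stripFreqY_le_one (k : ℕ) : stripAmplitude k * stripFreqY k ≤ 1 := by
  have h₁ : stripWidth k ^ 2 ≤ 1 :=
    pow_le_one₀ (stripWidth_pos k).le ((stripWidth_le k).trans (by norm_num))
  have h₂ : 1 ≤ (stripScale k : ℝ) ^ 2 := one_le_pow₀ (one_le_stripScale k)
  rw [stripAmplitude_mul_stripFreqY, div_le_one (by positivity)]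
  nlinarith [Real.pi_pos, Real.pi_lt_four]

/-- The exponents 3 and 2 of the frequencies make both terms proportional to the amplitude times
`stripWidth k ^ 2`. The constant 8192 yields the factor `1/128`, since `4 π² ≤ 40 < 64 = 8192 /
128`. -/
theorem quarticHamiltonian_strip_le (k : ℕ) :
    quarticHamiltonian !₂[stripAmplitude k * stripFreqX k, stripAmplitude k * stripFreqY k] ≤
      stripAmplitude k / 128 := by
  have hl := stripWidth_pos k
  have hl2 : stripWidth k ^ 2 ≤ 1 := pow_le_one₀ hl.le ((stripWidth_le k).trans (by norm_num))
  have hN := zero_lt_one.trans_le (one_le_stripScale k)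
  have hA := stripAmplitude_pos k
  have hpi : Real.pi ^ 2 ≤ 10 := by nlinarith [Real.pi_pos, Real.pi_lt_d2]
  have hpi0 : 0 ≤ Real.pi ^ 2 := sq_nonneg _
  have hpi' : Real.pi ^ 4 ≤ 100 := by nlinarith
  have e₁ : (stripAmplitude k * stripFreqX k) ^ 4 =
      stripAmplitude k * (Real.pi ^ 4 * stripWidth k ^ 2 / 8192 ^ 3) := by
    rw [stripAmplitude_mul_stripFreqX]
    unfold stripAmplitude
    field_simp
  have e₂ : (stripAmplitude k * stripFreqY k) ^ 2 =
      stripAmplitude k * (4 * Real.pi ^ 2 * stripWidth k ^ 2 / 8192) := by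
    rw [stripAmplitude_mul_stripFreqY]
    unfold stripAmplitude
    field_simp
    norm_num
  rw [quarticHamiltonian_eq]
  simp only [Matrix.cons_val_zero, Matrix.cons_val_one]
  rw [e₁, e₂]
  have h₁ : Real.pi ^ 4 * stripWidth k ^ 2 ≤ 100 * 1 :=
    mul_le_mul hpi' hl2 (by positivity) (by norm_num)
  have h₂ : Real.pi ^ 2 * stripWidth k ^ 2 ≤ 10 * 1 :=
    mul_le_mul hpi hl2 (by positivity) (by norm_num)
  have h₃ : 27 / 256 * (Real.pi ^ 4 * stripWidth k ^ 2 / 8192 ^ 3) +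
      4 * Real.pi ^ 2 * stripWidth k ^ 2 / 8192 ≤ 1 / 128 := by linarith
  have := mul_le_mul_of_nonneg_left h₃ hA.le
  linarith

theorem stripWave_nonneg (k : ℕ) (x : Euc 2) : 0 ≤ stripWave k x :=
  mul_nonneg (mul_nonneg (stripAmplitude_pos k).le (sinSqProfile_nonneg _ _))
    (sinSqProfile_nonneg _ _)

theorem stripWave_le_one (k : ℕ) (x : Euc 2) : stripWave k x ≤ 1 :=
  mul_le_one₀ (mul_le_one₀ (stripAmplitude_le_one k) (sinSqProfile_nonneg _ _)
    (sinSqProfile_le_one _ _)) (sinSqProfile_nonneg _ _) (sinSqProfile_le_one _ _)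

theorem stripWave_sub_le (k : ℕ) (x y : Euc 2) :
    stripWave k x - stripWave k y ≤ stripAmplitude k * stripFreqX k * |x 0 - y 0| +
      stripAmplitude k * stripFreqY k * |x 1 - y 1| := by
  have hA := stripAmplitude_pos k
  have key : ∀ (n : ℕ) {a : ℝ} (s r t : ℝ), 0 < a →
      sinSqProfile n (a * (r - s)) - sinSqProfile n (a * (t - s)) ≤ a * |r - t| := by
    intro n a s r t ha
    have h := (lipschitzWith_sinSqProfile n).dist_le_mul (a * (r - s)) (a * (t - s))
    rw [Real.dist_eq, Real.dist_eq, ← mul_sub, sub_sub_sub_cancel_right, abs_mul, abs_of_pos ha,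
      NNReal.coe_one, one_mul] at h
    exact (le_abs_self _).trans h
  have h₀ := key (stripScale k ^ 3) (stripWidth k) (x 0) (y 0) (stripFreqX_pos k)
  have h₁ := key (stripScale k ^ 2) (1 / 4) (x 1) (y 1) (stripFreqY_pos k)
  unfold stripWave
  set p := sinSqProfile (stripScale k ^ 3) (stripFreqX k * (x 0 - stripWidth k))
  set p' := sinSqProfile (stripScale k ^ 3) (stripFreqX k * (y 0 - stripWidth k))
  set q := sinSqProfile (stripScale k ^ 2) (stripFreqY k * (x 1 - 1 / 4))
  set q' := sinSqProfile (stripScale k ^ 2) (stripFreqY k * (y 1 - 1 / 4))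
  have e : stripAmplitude k * p * q - stripAmplitude k * p' * q' =
      stripAmplitude k * ((p - p') * q + (q - q') * p') := by ring
  have h₂ : (p - p') * q ≤ stripFreqX k * |x 0 - y 0| :=
    (mul_le_mul_of_nonneg_right h₀ (sinSqProfile_nonneg _ _)).trans
      (mul_le_of_le_one_right (mul_nonneg (stripFreqX_pos k).le (abs_nonneg _))
        (sinSqProfile_le_one _ _))
  have h₃ : (q - q') * p' ≤ stripFreqY k * |x 1 - y 1| :=
    (mul_le_mul_of_nonneg_right h₁ (sinSqProfile_nonneg _ _)).trans
      (mul_le_of_le_one_right (mul_nonneg (stripFreqY_pos k).le (abs_nonneg _))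
        (sinSqProfile_le_one _ _))
  rw [e, mul_assoc, mul_assoc, ← mul_add]
  exact mul_le_mul_of_nonneg_left (add_le_add h₂ h₃) hA.le

theorem stripWave_eq_zero {k : ℕ} {x : Euc 2} (h : x 0 ∉ Ioo (stripWidth k) (2 * stripWidth k)) :
    stripWave k x = 0 := by
  have ha := stripFreqX_pos k
  have : stripFreqX k * (x 0 - stripWidth k) ∉ Ioo 0 (((stripScale k ^ 3 : ℕ) : ℝ) * Real.pi) := by
    intro h'
    refine h ⟨?_, ?_⟩
    · have := pos_of_mul_pos_right h'.1 ha.le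
      linarith
    · have h₁ := h'.2
      rw [mul_comm, ← lt_div_iff₀ ha, stripScale_mul_pi_div_stripFreqX] at h₁
      linarith
  rw [stripWave, sinSqProfile_of_notMem this, mul_zero, zero_mul]

theorem bddAbove_stripWave (x : Euc 2) : BddAbove (range fun k => stripWave k x) :=
  ⟨1, by rintro _ ⟨k, rfl⟩; exact stripWave_le_one k x⟩

/-- This bound holds on the whole plane, which is the reason for a supremum of nonnegative waves:
rays that leave the strip need no separate treatment. -/
theorem stripWave_le_oscillatingDatum (k : ℕ) (x : Euc 2) :
    stripWave k x ≤ oscillatingDatum x :=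
  le_ciSup (bddAbove_stripWave x) k

theorem oscillatingDatum_eq_stripWave {k : ℕ} {x : Euc 2}
    (h : x 0 ∈ Icc (stripWidth k) (2 * stripWidth k)) : oscillatingDatum x = stripWave k x := by
  refine le_antisymm (ciSup_le fun j => ?_) (stripWave_le_oscillatingDatum k x)
  rcases eq_or_ne j k with rfl | hjk
  · exact le_rfl
  · rw [stripWave_eq_zero]
    · exact stripWave_nonneg k x
    · rintro ⟨h₁, h₂⟩
      rcases hjk.lt_or_gt with h' | h'
      · exact (h₁.trans_le h.2).not_ge (two_mul_stripWidth_le h')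
      · exact (h.1.trans_lt h₂).not_ge (two_mul_stripWidth_le h')

theorem lipschitzWith_oscillatingDatum : LipschitzWith 2 oscillatingDatum := by
  refine LipschitzWith.of_le_add_mul 2 fun x y => ciSup_le fun k => ?_
  have h := stripWave_sub_le k x y
  have hc : ∀ i, |x i - y i| ≤ dist x y := fun i => by
    rw [dist_eq_norm]
    exact abs_apply_le_norm (x - y) i
  have h₀ := mul_le_mul (stripAmplitude_mul_stripFreqX_le_one k) (hc 0) (abs_nonneg _) zero_le_one
  have h₁ := mul_le_mul (stripAmplitude_mul_stripFreqY_le_one k) (hc 1) (abs_nonneg _) zero_le_one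
  have h₂ := stripWave_le_oscillatingDatum k y
  rw [NNReal.coe_ofNat]
  linarith

/-- The Hamiltonian is even in each coordinate, so the signs of `P` and `Q` can be matched to those
of `z` before applying the Fenchel inequality. -/
theorem mul_abs_add_mul_abs_le (P Q : ℝ) (z : Euc 2) :
    P * |z 0| + Q * |z 1| ≤ quarticHamiltonian !₂[P, Q] + legendre quarticHamiltonian z := by
  have key : ∀ P' Q' : ℝ, P' ^ 4 = P ^ 4 → Q' ^ 2 = Q ^ 2 →
      P' * z 0 + Q' * z 1 ≤ quarticHamiltonian !₂[P, Q] + legendre quarticHamiltonian z := by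
    intro P' Q' hP hQ
    have h := isNormalizedHamiltonian_quarticHamiltonian.inner_le !₂[P', Q'] z
    rw [inner_euc_two, quarticHamiltonian_eq] at h
    rw [quarticHamiltonian_eq]
    simp only [Matrix.cons_val_zero, Matrix.cons_val_one] at h ⊢
    rwa [hP, hQ] at h
  rcases abs_choice (z 0) with h₀ | h₀ <;> rcases abs_choice (z 1) with h₁ | h₁ <;> rw [h₀, h₁]
  · exact key P Q rfl rfl
  · simpa using key P (-Q) rfl (by ring)
  · simpa using key (-P) Q (by ring) rfl
  · simpa using key (-P) (-Q) (by ring) (by ring)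

/-- On the `k`-th strip the solution at time `1` stays close to the initial datum, relatively to
the amplitude of the oscillation. -/
theorem abs_hopfLax_sub_stripWave_le {k : ℕ} {x : Euc 2}
    (h : x 0 ∈ Icc (stripWidth k) (2 * stripWidth k)) :
    |hopfLax quarticHamiltonian oscillatingDatum 1 x - stripWave k x| ≤
      stripAmplitude k / 128 := by
  have hH := isNormalizedHamiltonian_quarticHamiltonian
  have hu := lipschitzWith_oscillatingDatum
  have hA := stripAmplitude_pos k
  rw [abs_le]
  constructor
  -- Along the optimal ray the wave drops by at most `P |z 0| + Q |z 1|`, and the cost `L z`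
  -- compensates for all of this but `H (P, Q)`.
  · obtain ⟨z, hz⟩ := exists_hopfLax_eq hH hu zero_le_one x
    have h₁ := stripWave_le_oscillatingDatum k (x - (1 : ℝ) • z)
    have h₂ := stripWave_sub_le k x (x - (1 : ℝ) • z)
    have h₃ := mul_abs_add_mul_abs_le (stripAmplitude k * stripFreqX k)
      (stripAmplitude k * stripFreqY k) z
    have h₄ := quarticHamiltonian_strip_le k
    have e : ∀ i, x i - (x - (1 : ℝ) • z) i = z i := fun i => by simp
    rw [e, e] at h₂
    rw [one_mul] at hz
    linarith
  -- The stationary ray costs nothing.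
  · have h₁ := hopfLax_le hH hu zero_le_one x 0
    rw [hH.legendre_zero, smul_zero, sub_zero, mul_zero, add_zero,
      oscillatingDatum_eq_stripWave h] at h₁
    linarith

/-- The factor `κ` treats the gradient (`κ = 1`) and the velocity (`κ = 2`) together. -/
theorem variation_openUnitSquare_eq_top {F : Euc 2 → Euc 2} {κ : ℝ} (hκ : 1 ≤ κ)
    (hF : ∀ x, F x 1 =
      κ * gradient (hopfLax quarticHamiltonian oscillatingDatum 1) x 1) :
    variation F openUnitSquare = ⊤ := by
  have hlip := lipschitzWith_hopfLax isNormalizedHamiltonian_quarticHamiltonian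
    lipschitzWith_oscillatingDatum zero_le_one
  have hk : ∀ k : ℕ, ENNReal.ofReal (Real.pi ^ 2 / (8192 * 128) * (k + 1)) ≤
      variation F openUnitSquare := by
    intro k
    have hstrip : stripWidth k + ((stripScale k ^ 3 : ℕ) : ℝ) * Real.pi / stripFreqX k =
        2 * stripWidth k := by
      rw [stripScale_mul_pi_div_stripFreqX]
      ring
    have hl := stripWidth_pos k
    have hl' := stripWidth_le k
    have h := ofReal_le_variation_of_close hlip hκ hF (Ω := openUnitSquare)
      (A := stripAmplitude k) (a := stripFreqX k) (s := stripWidth k) (b := stripFreqY k)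
      (c := 1 / 4) (n := stripScale k ^ 3) (m := stripScale k ^ 2) (stripAmplitude_pos k).le
      (stripFreqX_pos k) (stripFreqY_pos k) (by
        rw [hstrip, stripScale_mul_pi_div_stripFreqY]
        rintro x ⟨h₀, h₁⟩ i
        fin_cases i
        · exact ⟨hl.trans_le h₀.1, h₀.2.trans_lt (by linarith)⟩
        · exact ⟨(by norm_num : (0 : ℝ) < 1 / 4).trans_le h₁.1, h₁.2.trans_lt (by norm_num)⟩)
      (fun x hx => abs_hopfLax_sub_stripWave_le (by rwa [hstrip] at hx))
    convert h using 2
    -- Amplitude times number of cells is `stripWidth k ^ 2 * stripScale k / 8192`, that is `(k + 1)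
    -- / 8192`.
    rw [← stripWidth_sq_mul_stripScale]
    have hN := (zero_lt_one.trans_le (one_le_stripScale k)).ne'
    unfold stripAmplitude
    push_cast
    field_simp
  have hlim : Tendsto (fun k : ℕ => ENNReal.ofReal (Real.pi ^ 2 / (8192 * 128) * (k + 1)))
      atTop (𝓝 ⊤) :=
    ENNReal.tendsto_ofReal_atTop.comp
      ((tendsto_atTop_add_const_right _ _ tendsto_natCast_atTop_atTop).const_mul_atTop
        (by positivity))
  exact top_unique (le_of_tendsto' hlim hk)

theorem isOpen_openUnitSquare : IsOpen openUnitSquare := by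
  simp only [openUnitSquare, ofPred_forall]
  exact isOpen_iInter_of_finite fun i =>
    isOpen_Ioo.preimage (EuclideanSpace.proj (𝕜 := ℝ) i).continuous

theorem isBounded_openUnitSquare : Bornology.IsBounded openUnitSquare := by
  refine (isCompact_rectangle (isCompact_Icc (a := (0 : ℝ)) (b := 1))
    (isCompact_Icc (a := (0 : ℝ)) (b := 1))).isBounded.subset fun x hx => ?_
  exact ⟨Ioo_subset_Icc_self (hx 0), Ioo_subset_Icc_self (hx 1)⟩

theorem openUnitSquare_subset_closedUnitSquare : openUnitSquare ⊆ closedUnitSquare :=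
  fun _ hx i => Ioo_subset_Icc_self (hx i)

theorem not_memBVLoc_of_variation_eq_top {m : ℕ} {F : Euc 2 → Euc m}
    (h : variation F openUnitSquare = ⊤) : ¬ MemBVLoc F := fun hF =>
  (hF openUnitSquare isOpen_openUnitSquare isBounded_openUnitSquare).2.ne h

end Construction

end HamiltonJacobi

/-! ### The main theorem. -/

theorem mainTheorem6 :
    (StrictConvexOn ℝ univ HamiltonJacobi.quarticHamiltonian ∧
      HamiltonJacobi.Coercive HamiltonJacobi.quarticHamiltonian ∧
      ContDiff ℝ 2 HamiltonJacobi.quarticHamiltonian ∧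
      ¬ HamiltonJacobi.UniformlyDirectionallyConvex HamiltonJacobi.quarticHamiltonian) ∧
    ∃ (ubar : HamiltonJacobi.Euc 2 → ℝ) (u : ℝ → HamiltonJacobi.Euc 2 → ℝ)
      (b : HamiltonJacobi.Euc 2 → HamiltonJacobi.Euc 2),
      (∃ K : ℝ≥0, LipschitzWith K ubar) ∧
      -- `u` is the solution `S_t ubar`, and `b` is the velocity field at time `1`
      u = HamiltonJacobi.hopfLax HamiltonJacobi.quarticHamiltonian ubar ∧
      HamiltonJacobi.IsViscositySolution HamiltonJacobi.quarticHamiltonian ubar u ∧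
      b = HamiltonJacobi.velocity HamiltonJacobi.quarticHamiltonian ubar 1 ∧
      (∀ᵐ x, DifferentiableAt ℝ (u 1) x ∧
        HamiltonJacobi.backwardSlopes HamiltonJacobi.quarticHamiltonian ubar 1 x = {b x}) ∧
      -- both fields are locally integrable, with infinite total variation on the unit square
      LocallyIntegrable (gradient (u 1)) ∧ LocallyIntegrable b ∧
      HamiltonJacobi.variationOn (gradient (u 1)) HamiltonJacobi.closedUnitSquare = ⊤ ∧
      HamiltonJacobi.variationOn b HamiltonJacobi.closedUnitSquare = ⊤ ∧
      HamiltonJacobi.variation (gradient (u 1)) HamiltonJacobi.openUnitSquare = ⊤ ∧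
      HamiltonJacobi.variation b HamiltonJacobi.openUnitSquare = ⊤ ∧
      -- hence neither is of locally bounded variation
      ¬ HamiltonJacobi.MemBVLoc (gradient (u 1)) ∧ ¬ HamiltonJacobi.MemBVLoc b := by
  have hH := HamiltonJacobi.isNormalizedHamiltonian_quarticHamiltonian
  have hu := HamiltonJacobi.lipschitzWith_oscillatingDatum
  have hlip := HamiltonJacobi.lipschitzWith_hopfLax hH hu zero_le_one
  have hgrad : HamiltonJacobi.variation
      (gradient (HamiltonJacobi.hopfLax HamiltonJacobi.quarticHamiltonian
        HamiltonJacobi.oscillatingDatum 1)) HamiltonJacobi.openUnitSquare = ⊤ :=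
    HamiltonJacobi.variation_openUnitSquare_eq_top le_rfl fun x => (one_mul _).symm
  have hvel : HamiltonJacobi.variation
      (HamiltonJacobi.velocity HamiltonJacobi.quarticHamiltonian
        HamiltonJacobi.oscillatingDatum 1) HamiltonJacobi.openUnitSquare = ⊤ :=
    HamiltonJacobi.variation_openUnitSquare_eq_top one_le_two fun x => by
      rw [HamiltonJacobi.velocity, HamiltonJacobi.gradient_quarticHamiltonian]
      rfl
  refine ⟨⟨hH.strictConvexOn, HamiltonJacobi.coercive_quarticHamiltonian,
    HamiltonJacobi.contDiff_quarticHamiltonian,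
    HamiltonJacobi.not_uniformlyDirectionallyConvex_quarticHamiltonian⟩,
    HamiltonJacobi.oscillatingDatum, _, _, ⟨2, hu⟩, rfl,
    HamiltonJacobi.isViscositySolution_hopfLax hH hu, rfl, ?_,
    HamiltonJacobi.locallyIntegrable_gradient hlip,
    HamiltonJacobi.locallyIntegrable_comp_gradient hlip
      HamiltonJacobi.continuous_gradient_quarticHamiltonian,
    HamiltonJacobi.variationOn_eq_top_of_subset
      HamiltonJacobi.openUnitSquare_subset_closedUnitSquare hgrad,
    HamiltonJacobi.variationOn_eq_top_of_subset
      HamiltonJacobi.openUnitSquare_subset_closedUnitSquare hvel,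
    hgrad, hvel, HamiltonJacobi.not_memBVLoc_of_variation_eq_top hgrad,
    HamiltonJacobi.not_memBVLoc_of_variation_eq_top hvel⟩
  filter_upwards [hlip.ae_differentiableAt] with x hx
  exact ⟨hx, HamiltonJacobi.backwardSlopes_eq_singleton hH hu one_pos hx⟩
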